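/- **Model.** Let $\underline\mu<\bar\mu$, $\underline p<\bar p$, $\mathcal B=[\underline\mu,\bar\mu]\times[\underline p,\bar p]$ and $h_0\in\mathbb R$. Let $\lambda:[\underline p,\bar p]\to(0,\infty)$ be continuously differentiable and non-increasing, let $c:[\underline\mu,\bar\mu]\to\mathbb R$ be continuously differentiable and non-decreasing, and suppose $\lambda(\underline p)<\underline\mu$. Let $(U_t)_{t\ge1}$ and $(V_t)_{t\ge1}$ be two independent i.i.d. sequences of nonnegative random variables with $\mathbb E U_t=\mathbb E V_t=1$. Suppose that there is $\eta>0$ with $\mathbb E e^{\eta U_1}<\infty$ and $\mathbb E e^{\eta V_1}<\infty$, and that there are constants $0<\theta<\eta/(2\bar\mu)$, $0<a<\frac{\underline\mu-\lambda(\underline p)}{\underline\mu+\lambda(\underline p)}$ and $\gamma_1>0$ such that $$\log\mathbb E e^{-\theta U_1/(1-a)}<-\theta-\gamma_1/2,\qquad \log\mathbb E e^{\theta V_1/(1+a)}<\theta-\gamma_1/2$$ (in particular $\mathbb E e^{\theta V_1/(1+a)}<\infty$). **Steady state.** For fixed $(\mu,p)\in\mathcal B$ consider the Markov chain on $[0,\infty)^2$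 (waiting time and observed busy period) $$W_{t+1}=\Big(W_t-\frac{U_t}{\lambda(p)}+\frac{V_t}{\mu}\Big)_+,\qquad Y_{t+1}=\Big(Y_t+\frac{U_t}{\lambda(p)}\Big)\mathbf 1(W_{t+1}>0).$$ **Algorithm (SAMCMC).** Let $\gamma>0$, $\eta_t=\gamma/t$, $(\mu_1,p_1)\in\mathcal B$, $w_1=y_1=0$, and for $t\ge1$ let $$w_{t+1}=\Big(w_t-\frac{U_t}{\lambda(p_t)}+\frac{V_t}{\mu_t}\Big)_+,\qquad y_{t+1}=\Big(y_t+\frac{U_t}{\lambda(p_t)}\Big)\mathbf 1(w_{t+1}>0),$$ $$(\mu_{t+1},p_{t+1})=\Pi_{\mathcal B}\big((\mu_t,p_t)-\eta_t(H^\mu_t,H^p_t)\big),$$ where $\Pi_{\mathcal B}$ is the Euclidean projection onto $\mathcal B$ and $$H^\mu_t=c'(\mu_t)-h_0\frac{\lambda(p_t)}{\mu_t}\Big(w_t+y_t+\frac1{\mu_t}\Big),\qquad H^p_t=-\lambda(p_t)-p_t\lambda'(p_t)+h_0\lambda'(p_t)\Big(w_t+y_t+\frac1{\mu_t}\Big).$$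 **Claim.** For every $(\mu,p)\in\mathcal B$ the chain $(W_t,Y_t)$ has a unique stationary distribution, that is, the law of a pair $(W_\infty(\mu,p),Y_\infty(\mu,p))$, and $m(\mu,p):=\mathbb E W_\infty(\mu,p)$ is finite. For every $t\ge1$ the random variables $w_t$ and $m(\mu_t,p_t)$ are integrable, and there is a constant $C$, not depending on $t$, such that $$\big|\mathbb E[w_t]-\mathbb E[m(\mu_t,p_t)]\big|\le\frac Ct\qquad\text{for all }t\ge1.$$ -/

import Mathlib

open MeasureTheory ProbabilityTheory Set

/-- Data of the joint pricing and capacity sizing problem for a GI/GI/1 queue: holding cost `h0`,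
demand rate `lam` (a function of the price `p`), staffing cost `c` (a function of the service
rate `μ`), and the feasible box `[muL, muU] × [pL, pU]` of pairs `(μ, p)`. -/
structure PricingModel where
  h0 : ℝ
  lam : ℝ → ℝ
  c : ℝ → ℝ
  muL : ℝ
  muU : ℝ
  pL : ℝ
  pU : ℝ

/-- The current parameter `(mu, p)` together with the queueing state
(waiting time `w`, observed busy period `y`). -/
structure Iterate where
  mu : ℝ
  p : ℝ
  w : ℝ
  y : ℝ

namespace PricingModel

/-- Demand rate, staffing cost and uniform stability. The demand rate is a positive rate on the
feasible prices. -/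
structure UniformlyStable (M : PricingModel) : Prop where
  mu_lt : M.muL < M.muU
  p_lt : M.pL < M.pU
  lam_pos : ∀ p ∈ Icc M.pL M.pU, 0 < M.lam p
  lam_contDiff : ContDiffOn ℝ 1 M.lam (Icc M.pL M.pU)
  lam_anti : AntitoneOn M.lam (Icc M.pL M.pU)
  c_contDiff : ContDiffOn ℝ 1 M.c (Icc M.muL M.muU)
  c_mono : MonotoneOn M.c (Icc M.muL M.muU)
  stable : M.lam M.pL < M.muL

/-- One step of the pair (waiting time, observed busy period) under the parameter `(μ, p)`, where
`u` and `v` are the unscaled interarrival and service times. -/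
noncomputable def queueStep (M : PricingModel) (μ p : ℝ) (x : ℝ × ℝ) (u v : ℝ) : ℝ × ℝ :=
  (max (x.1 - u / M.lam p + v / μ) 0,
    if 0 < max (x.1 - u / M.lam p + v / μ) 0 then x.2 + u / M.lam p else 0)

/-- `π` is a stationary distribution, on the state space `[0, ∞) × [0, ∞)`, of the pair
(waiting time, observed busy period) under the fixed parameter `(μ, p)`, when the unscaled
interarrival and service times are independent with laws `νU` and `νV`. -/
structure IsStationary (M : PricingModel) (νU νV : Measure ℝ) (μ p : ℝ)
    (π : Measure (ℝ × ℝ)) : Prop where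
  prob : IsProbabilityMeasure π
  nonneg : ∀ᵐ x ∂π, 0 ≤ x.1 ∧ 0 ≤ x.2
  invariant : (π.prod (νU.prod νV)).map (fun z => M.queueStep μ p z.1 z.2.1 z.2.2) = π

open Classical in
/-- The law of `(W_∞(μ, p), Y_∞(μ, p))`: the unique stationary distribution
(and `0` if there is no unique one). -/
noncomputable def steadyLaw (M : PricingModel) (νU νV : Measure ℝ) (μ p : ℝ) :
    Measure (ℝ × ℝ) :=
  if h : ∃! π : Measure (ℝ × ℝ), M.IsStationary νU νV μ p π then h.exists.choose else 0

/-- The steady-state mean waiting time `E W_∞(μ, p)`, a function of `(μ, p)`. -/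
noncomputable def steadyMeanWait (M : PricingModel) (νU νV : Measure ℝ) (μ p : ℝ) : ℝ :=
  ∫ x, x.1 ∂(M.steadyLaw νU νV μ p)

/-- The `μ`-component of the gradient estimator `H`. -/
noncomputable def gradMu (M : PricingModel) (s : Iterate) : ℝ :=
  derivWithin M.c (Icc M.muL M.muU) s.mu
    - M.h0 * (M.lam s.p / s.mu) * (s.w + s.y + 1 / s.mu)

/-- The `p`-component of the gradient estimator `H`. -/
noncomputable def gradP (M : PricingModel) (s : Iterate) : ℝ :=
  -M.lam s.p - s.p * derivWithin M.lam (Icc M.pL M.pU) s.p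
    + M.h0 * derivWithin M.lam (Icc M.pL M.pU) s.p * (s.w + s.y + 1 / s.mu)

/-- One iteration of the algorithm, with step size `η` and unscaled interarrival and service times
`u`, `v`. The parameter makes a gradient step and is projected to the feasible box (the Euclidean
projection onto a box truncates each coordinate); the queue makes one step under the
current parameter. -/
noncomputable def iterateStep (M : PricingModel) (η u v : ℝ) (s : Iterate) : Iterate where
  mu := max M.muL (min M.muU (s.mu - η * M.gradMu s))
  p := max M.pL (min M.pU (s.p - η * M.gradP s))
  w := (M.queueStep s.mu s.p (s.w, s.y) u v).1
  y := (M.queueStep s.mu s.p (s.w, s.y) u v).2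

/-- The run of the algorithm with step sizes `η 1, η 2, …`, started from an empty queue and the
parameter `(μ₁, p₁)`. The entry with index `n` is the iterate `t = n + 1`, and `u n`, `v n` are the
unscaled interarrival and service times used in iteration `t = n + 1`. -/
noncomputable def samcmc (M : PricingModel) (η : ℕ → ℝ) (μ₁ p₁ : ℝ) (u v : ℕ → ℝ) : ℕ → Iterate
  | 0 => ⟨μ₁, p₁, 0, 0⟩
  | n + 1 => M.iterateStep (η (n + 1)) (u n) (v n) (M.samcmc η μ₁ p₁ u v n)

/-- Light-tailed service and interarrival times. The last integrability condition says that the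
cumulant generating function of `V` is finite at the point where it is evaluated (for the
nonnegative `U` and a negative argument this is automatic). -/
def LightTailed {Ω : Type*} [MeasurableSpace Ω] (M : PricingModel) (P : Measure Ω)
    (U V : Ω → ℝ) : Prop :=
  ∃ η > 0, Integrable (fun ω => Real.exp (η * V ω)) P ∧
    Integrable (fun ω => Real.exp (η * U ω)) P ∧
    ∃ θ a γ : ℝ, 0 < θ ∧ θ < η / (2 * M.muU) ∧
      0 < a ∧ a < (M.muL - M.lam M.pL) / (M.muL + M.lam M.pL) ∧ 0 < γ ∧
      cgf U P (-θ / (1 - a)) < -θ - γ / 2 ∧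
      cgf V P (θ / (1 + a)) < θ - γ / 2 ∧
      Integrable (fun ω => Real.exp (θ / (1 + a) * V ω)) P

end PricingModel

/-- Two independent i.i.d. sequences of nonnegative random variables with unit means. -/
structure IsPrimitiveInput {Ω : Type*} [MeasurableSpace Ω] (P : Measure Ω)
    (U V : ℕ → Ω → ℝ) : Prop where
  measurable_U : ∀ n, Measurable (U n)
  measurable_V : ∀ n, Measurable (V n)
  nonneg_U : ∀ n, ∀ᵐ ω ∂P, 0 ≤ U n ω
  nonneg_V : ∀ n, ∀ᵐ ω ∂P, 0 ≤ V n ω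
  iIndep_U : iIndepFun U P
  iIndep_V : iIndepFun V P
  indep_UV : IndepFun (fun ω n => U n ω) (fun ω n => V n ω) P
  ident_U : ∀ n, IdentDistrib (U n) (U 0) P P
  ident_V : ∀ n, IdentDistrib (V n) (V 0) P P
  integrable_U : Integrable (U 0) P
  integrable_V : Integrable (V 0) P
  mean_U : ∫ ω, U 0 ω ∂P = 1
  mean_V : ∫ ω, V 0 ω ∂P = 1

/-! Write q = 1/λ(p) and r = 1/μ, so that the waiting time follows a Lindley recursion with
increments rV - qU. Since q ≥ q₀ = 1/λ(pL) and r ≤ r₀ = 1/muL on the box, every increment is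
dominated by r₀V - q₀U, whatever the parameters. The light-tail assumption makes E exp(β r₀V - (β-ε)
q₀U) less than 1 (`PricingModel.exists_expDrift`). The spare ε lets exp(βw + εy) serve as a Lyapunov
function for the algorithm (`AdaptiveQueue.moment_le`).

Let f_j(q, r, w) be the mean wait after j steps with frozen parameters (`meanWait`). Queues driven
by the same inputs are all empty as soon as a common upper bound is pushed to 0, and the exponential
drift makes survival up to time j geometrically unlikely. Hence differences of f_j in the initial
state, and also mixed differences in state and parameters, are at most a constant times s^j
(`ExpDrift.abs_meanWait_mixed_le`). Summing over j shows that f_j - m, with m the stationary mean,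
is Lipschitz in (q, r) with constant of order s^j exp(βw/2)
(`ExpDrift.exists_abs_meanWait_sub_limit_le`).

For fixed n put a_i = E[f_{n-i}(q_i, r_i, w_i) - m(q_i, r_i)]. Then a_n is the quantity to bound,
and a_0 is geometrically small because the initial parameter is deterministic. By the Markov
property, a_{i+1} - a_i involves only the replacement of the i-th parameter by the next one. This
change is O((1 + w + y)/(i+1)), so the difference is O(s^(n-1-i)/(i+1)) after the moment bounds
(`AdaptiveQueue.exists_abs_integral_update_le`). Convolving a geometric with a harmonic sequence
gives O(1/(n+1)).

The stationary law is the normalized occupation measure of a cycle between visits to the empty state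
(`ExpDrift.exists_stationary`). Uniqueness follows from the coupling above
(`ExpDrift.stationary_unique`). -/

/-! ### Lindley recursion and exponential drift. -/

/-- One step of the Lindley recursion with scaling factors `q` and `r` of the interarrival time
`z.1` and the service time `z.2`. -/
noncomputable def lindleyStep (q r w : ℝ) (z : ℝ × ℝ) : ℝ := max (w - z.1 * q + z.2 * r) 0

/-- The mean waiting time after `j` Lindley steps from `w`. -/
noncomputable def meanWait (ν : Measure (ℝ × ℝ)) : ℕ → ℝ → ℝ → ℝ → ℝ
  | 0, _, _, w => w
  | j + 1, q, r, w => ∫ z, meanWait ν j q r (lindleyStep q r w z) ∂ν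

/-- The increments `z.2 * r - z.1 * q` with `q₀ ≤ q` and `0 ≤ r ≤ r₀` have a negative exponential
drift, with room for an additional term `ε * (z.1 * q₀)`. -/
structure ExpDrift (ν : Measure (ℝ × ℝ)) (q₀ r₀ β ε ρ : ℝ) : Prop where
  nonneg : ∀ᵐ z ∂ν, 0 ≤ z.1 ∧ 0 ≤ z.2
  integrable_fst : Integrable (fun z : ℝ × ℝ => z.1) ν
  integrable_snd : Integrable (fun z : ℝ × ℝ => z.2) ν
  q₀_pos : 0 < q₀
  r₀_pos : 0 < r₀
  ε_pos : 0 < ε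
  ε_le : ε ≤ β
  ρ_pos : 0 < ρ
  ρ_lt : ρ < 1
  integrable_exp : Integrable
    (fun z : ℝ × ℝ => Real.exp (β * (z.2 * r₀) - (β - ε) * (z.1 * q₀))) ν
  integral_exp_le : ∫ z : ℝ × ℝ, Real.exp (β * (z.2 * r₀) - (β - ε) * (z.1 * q₀)) ∂ν ≤ ρ
  integrable_weighted : Integrable
    (fun z : ℝ × ℝ => Real.exp (β / 2 * (z.2 * r₀)) * (1 + z.1 + z.2)) ν

lemma lindleyStep_nonneg (q r w : ℝ) (z : ℝ × ℝ) : 0 ≤ lindleyStep q r w z := le_max_right _ _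

lemma abs_lindleyStep_sub_le (q r w q' r' w' : ℝ) {z : ℝ × ℝ} (hz : 0 ≤ z.1 ∧ 0 ≤ z.2) :
    |lindleyStep q r w z - lindleyStep q' r' w' z| ≤
      |w - w'| + (|q - q'| + |r - r'|) * (z.1 + z.2) := by
  have h1 : |lindleyStep q r w z - lindleyStep q' r' w' z| ≤
      |(w - z.1 * q + z.2 * r) - (w' - z.1 * q' + z.2 * r')| := by
    unfold lindleyStep
    exact abs_max_sub_max_le_abs _ _ _
  have h2 : (w - z.1 * q + z.2 * r) - (w' - z.1 * q' + z.2 * r')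
      = (w - w') + (-(z.1 * (q - q')) + z.2 * (r - r')) := by ring
  have h3 : |(-(z.1 * (q - q')) + z.2 * (r - r'))| ≤ z.1 * |q - q'| + z.2 * |r - r'| := by
    refine (abs_add_le _ _).trans ?_
    rw [abs_neg, abs_mul, abs_mul, abs_of_nonneg hz.1, abs_of_nonneg hz.2]
  rw [h2] at h1
  have h4 := abs_add_le (w - w') (-(z.1 * (q - q')) + z.2 * (r - r'))
  nlinarith [mul_nonneg hz.1 (abs_nonneg (r - r')), mul_nonneg hz.2 (abs_nonneg (q - q'))]

lemma measurable_lindleyStep :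
    Measurable (fun x : (ℝ × ℝ × ℝ) × ℝ × ℝ => lindleyStep x.1.1 x.1.2.1 x.1.2.2 x.2) := by
  unfold lindleyStep; fun_prop

lemma measurable_meanWait (ν : Measure (ℝ × ℝ)) [IsProbabilityMeasure ν] (j : ℕ) :
    Measurable (fun x : ℝ × ℝ × ℝ => meanWait ν j x.1 x.2.1 x.2.2) := by
  induction j with
  | zero => simp only [meanWait]; fun_prop
  | succ j ih =>
    simp only [meanWait]
    have h : Measurable (fun x : (ℝ × ℝ × ℝ) × ℝ × ℝ =>
        meanWait ν j x.1.1 x.1.2.1 (lindleyStep x.1.1 x.1.2.1 x.1.2.2 x.2)) :=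
      ih.comp ((measurable_fst.comp measurable_fst).prodMk
        ((measurable_fst.comp (measurable_snd.comp measurable_fst)).prodMk measurable_lindleyStep))
    exact (h.stronglyMeasurable.integral_prod_right' (ν := ν)).measurable

lemma measurable_meanWait_right (ν : Measure (ℝ × ℝ)) [IsProbabilityMeasure ν] (j : ℕ) (q r : ℝ) :
    Measurable (meanWait ν j q r) :=
  (measurable_meanWait ν j).comp
    (measurable_const.prodMk (measurable_const.prodMk measurable_id) : Measurable
      (fun w : ℝ => (q, r, w)))

lemma ExpDrift.β_pos {ν : Measure (ℝ × ℝ)} {q₀ r₀ β ε ρ : ℝ} (h : ExpDrift ν q₀ r₀ β ε ρ) :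
    0 < β := h.ε_pos.trans_le h.ε_le

lemma ExpDrift.integrable_exp_half_mul {ν : Measure (ℝ × ℝ)} {q₀ r₀ β ε ρ : ℝ}
    (h : ExpDrift ν q₀ r₀ β ε ρ) :
    Integrable (fun z : ℝ × ℝ =>
      Real.exp (β / 2 * (z.2 * r₀ - z.1 * q₀)) * (z.1 + z.2)) ν := by
  refine h.integrable_weighted.mono' (by fun_prop) ?_
  filter_upwards [h.nonneg] with z hz
  have := h.β_pos
  have := h.q₀_pos
  have hzz := add_nonneg hz.1 hz.2
  rw [Real.norm_eq_abs, abs_of_nonneg (by positivity)]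
  have : 0 ≤ z.1 * q₀ := mul_nonneg hz.1 h.q₀_pos.le
  gcongr <;> linarith

lemma ExpDrift.integrable_exp_half {ν : Measure (ℝ × ℝ)} {q₀ r₀ β ε ρ : ℝ}
    (h : ExpDrift ν q₀ r₀ β ε ρ) :
    Integrable (fun z : ℝ × ℝ => Real.exp (β / 2 * (z.2 * r₀ - z.1 * q₀))) ν := by
  refine h.integrable_weighted.mono' (by fun_prop) ?_
  filter_upwards [h.nonneg] with z hz
  have := h.β_pos
  rw [Real.norm_eq_abs, abs_of_nonneg (by positivity)]
  have : 0 ≤ z.1 * q₀ := mul_nonneg hz.1 h.q₀_pos.le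
  calc _ ≤ Real.exp (β / 2 * (z.2 * r₀)) := by gcongr; linarith
    _ ≤ _ := le_mul_of_one_le_right (Real.exp_pos _).le (by linarith)

/-! ### Frozen parameters: sensitivity of mean waiting times to state and parameters. -/

section Drift

variable {ν : Measure (ℝ × ℝ)} [IsProbabilityMeasure ν] {q₀ r₀ β ε ρ : ℝ}

lemma ExpDrift.integrable_lindleyStep (h : ExpDrift ν q₀ r₀ β ε ρ) (q r w : ℝ) :
    Integrable (lindleyStep q r w) ν := by
  unfold lindleyStep
  exact ((((integrable_const w).sub (h.integrable_fst.mul_const q)).add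
    (h.integrable_snd.mul_const r)).sup (integrable_const 0))

lemma integrable_of_abs_sub_le {X : Type*} [MeasurableSpace X] {π : Measure X}
    [IsFiniteMeasure π] {f : ℝ → ℝ} (hf : Measurable f) (hl : ∀ a b, |f a - f b| ≤ |a - b|)
    {g : X → ℝ} (hg : Integrable g π) : Integrable (fun x => f (g x)) π := by
  refine ((integrable_const |f 0|).add hg.norm).mono'
    (hf.comp_aemeasurable hg.aemeasurable).aestronglyMeasurable (Filter.Eventually.of_forall ?_)
  intro x
  have h1 := hl (g x) 0
  have h2 := abs_sub_abs_le_abs_sub (f (g x)) (f 0)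
  simp only [Real.norm_eq_abs, sub_zero, Pi.add_apply] at *
  linarith

/-- Synchronous coupling: with the same inputs, each step is 1-Lipschitz in the state. -/
lemma ExpDrift.abs_meanWait_sub_le (h : ExpDrift ν q₀ r₀ β ε ρ) (j : ℕ) (q r a b : ℝ) :
    |meanWait ν j q r a - meanWait ν j q r b| ≤ |a - b| := by
  induction j generalizing a b with
  | zero => simp [meanWait]
  | succ j ih =>
    simp only [meanWait]
    have hi : ∀ w, Integrable (fun z => meanWait ν j q r (lindleyStep q r w z)) ν := fun w =>
      integrable_of_abs_sub_le (measurable_meanWait_right ν j q r) ih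
        (h.integrable_lindleyStep q r w)
    rw [← integral_sub (hi a) (hi b)]
    calc _ ≤ ∫ z, |meanWait ν j q r (lindleyStep q r a z) -
          meanWait ν j q r (lindleyStep q r b z)| ∂ν := abs_integral_le_integral_abs
      _ ≤ ∫ _, |a - b| ∂ν := by
          refine integral_mono ((hi a).sub (hi b)).abs (integrable_const _) fun z => ?_
          refine (ih _ _).trans ((abs_max_sub_max_le_abs _ _ _).trans (le_of_eq ?_))
          congr 1; ring
      _ = _ := by simp

lemma ExpDrift.integrable_meanWait (h : ExpDrift ν q₀ r₀ β ε ρ) (j : ℕ) (q r w : ℝ) :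
    Integrable (fun z => meanWait ν j q r (lindleyStep q r w z)) ν :=
  integrable_of_abs_sub_le (measurable_meanWait_right ν j q r) (h.abs_meanWait_sub_le j q r)
    (h.integrable_lindleyStep q r w)

lemma lindleyStep_le {q r w M : ℝ} (hq : q₀ ≤ q) (hr : r ≤ r₀) (hw : w ≤ M)
    {z : ℝ × ℝ} (hz : 0 ≤ z.1 ∧ 0 ≤ z.2) :
    lindleyStep q r w z ≤ max (M + (z.2 * r₀ - z.1 * q₀)) 0 := by
  unfold lindleyStep
  refine max_le_max ?_ le_rfl
  nlinarith [mul_le_mul_of_nonneg_left hq hz.1, mul_le_mul_of_nonneg_left hr hz.2]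

lemma integral_sub_sub_add {X : Type*} [MeasurableSpace X] {π : Measure X} {f g k l : X → ℝ}
    (hf : Integrable f π) (hg : Integrable g π) (hk : Integrable k π) (hl : Integrable l π) :
    ∫ x, (f x - g x - k x + l x) ∂π =
      ∫ x, f x ∂π - ∫ x, g x ∂π - ∫ x, k x ∂π + ∫ x, l x ∂π := by
  rw [integral_add (f := fun x => f x - g x - k x) ((hf.sub hg).sub hk) hl,
    integral_sub (f := fun x => f x - g x) (hf.sub hg) hk, integral_sub hf hg]

/-- The mixed difference of mean waiting times in the initial state and in the parameters decays
geometrically in the number of steps. -/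
lemma ExpDrift.abs_meanWait_mixed_le (h : ExpDrift ν q₀ r₀ β ε ρ) {α ρ' κ s C : ℝ}
    (hE : Integrable (fun z : ℝ × ℝ => Real.exp (α * (z.2 * r₀ - z.1 * q₀))) ν)
    (hE' : ∫ z : ℝ × ℝ, Real.exp (α * (z.2 * r₀ - z.1 * q₀)) ∂ν ≤ ρ')
    (hK : Integrable
      (fun z : ℝ × ℝ => Real.exp (α * (z.2 * r₀ - z.1 * q₀)) * (z.1 + z.2)) ν)
    (hK' : ∫ z : ℝ × ℝ, Real.exp (α * (z.2 * r₀ - z.1 * q₀)) * (z.1 + z.2) ∂ν ≤ κ)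
    (hα : 0 ≤ α) (hs : ρ' ≤ s) (hs0 : 0 ≤ s) (hC : 0 ≤ C) (hsC : ρ' * C + 2 * κ ≤ s * C)
    {q r q' r' : ℝ} (hq : q₀ ≤ q) (hr : r ≤ r₀) (hq' : q₀ ≤ q') (hr' : r' ≤ r₀)
    (j : ℕ) (a b a' b' M : ℝ) (hM : 0 ≤ M) (ha : a ≤ M) (hb : b ≤ M) (ha' : a' ≤ M)
    (hb' : b' ≤ M) :
    |meanWait ν j q r a - meanWait ν j q r b - meanWait ν j q' r' a' + meanWait ν j q' r' b'| ≤
      s ^ j * (Real.exp (α * M) *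
        (|a - a'| + |b - b'| + C * (|q - q'| + |r - r'|))) := by
  have hd : 0 ≤ |q - q'| + |r - r'| := by positivity
  induction j generalizing a b a' b' M with
  | zero =>
    simp only [meanWait, pow_zero, one_mul]
    have h1 : a - b - a' + b' = (a - a') - (b - b') := by ring
    have h2 : |a - b - a' + b'| ≤ |a - a'| + |b - b'| := by rw [h1]; exact abs_sub _ _
    have h3 : (1 : ℝ) ≤ Real.exp (α * M) := Real.one_le_exp (by positivity)
    have h4 : 0 ≤ C * (|q - q'| + |r - r'|) := by positivity
    nlinarith [abs_nonneg (a - a'), abs_nonneg (b - b')]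
  | succ j ih =>
    simp only [meanWait]
    rw [← integral_sub_sub_add (h.integrable_meanWait j q r a) (h.integrable_meanWait j q r b)
      (h.integrable_meanWait j q' r' a') (h.integrable_meanWait j q' r' b')]
    set d := |q - q'| + |r - r'| with hd_def
    set D := |a - a'| + |b - b'| with hD_def
    have hD : 0 ≤ D := by positivity
    have hpt : ∀ᵐ z ∂ν, ‖meanWait ν j q r (lindleyStep q r a z) -
        meanWait ν j q r (lindleyStep q r b z) - meanWait ν j q' r' (lindleyStep q' r' a' z) +
        meanWait ν j q' r' (lindleyStep q' r' b' z)‖ ≤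
        s ^ j * Real.exp (α * M) * ((D + C * d) * Real.exp (α * (z.2 * r₀ - z.1 * q₀)) +
          2 * d * (Real.exp (α * (z.2 * r₀ - z.1 * q₀)) * (z.1 + z.2))) := by
      filter_upwards [h.nonneg] with z hz
      rw [Real.norm_eq_abs]
      have la := lindleyStep_le hq hr ha hz
      have lb := lindleyStep_le hq hr hb hz
      have la' := lindleyStep_le hq' hr' ha' hz
      have lb' := lindleyStep_le hq' hr' hb' hz
      have hzz : 0 ≤ z.1 + z.2 := add_nonneg hz.1 hz.2
      -- `M` dominates all four waiting times. If the dominating increment takes it to 0 or below,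
      -- all four queues are empty and the mixed difference vanishes. Otherwise the new bound is `M`
      -- plus the increment, and the weight `exp (α * M)` picks up exactly the factor whose mean is
      -- at most `ρ'`.
      rcases le_or_gt (M + (z.2 * r₀ - z.1 * q₀)) 0 with hx | hx
      · rw [max_eq_right hx] at la lb la' lb'
        rw [le_antisymm la (lindleyStep_nonneg _ _ _ _),
          le_antisymm lb (lindleyStep_nonneg _ _ _ _),
          le_antisymm la' (lindleyStep_nonneg _ _ _ _),
          le_antisymm lb' (lindleyStep_nonneg _ _ _ _)]
        simp only [sub_self, zero_sub, neg_add_cancel, abs_zero]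
        positivity
      · rw [max_eq_left hx.le] at la lb la' lb'
        refine (ih _ _ _ _ _ hx.le la lb la' lb').trans ?_
        have e1 := abs_lindleyStep_sub_le q r a q' r' a' hz
        have e2 := abs_lindleyStep_sub_le q r b q' r' b' hz
        rw [mul_add α, Real.exp_add]
        have e3 : |lindleyStep q r a z - lindleyStep q' r' a' z| +
            |lindleyStep q r b z - lindleyStep q' r' b' z| + C * d ≤
            D + C * d + 2 * d * (z.1 + z.2) := by linarith
        calc _ ≤ s ^ j * (Real.exp (α * M) * Real.exp (α * (z.2 * r₀ - z.1 * q₀)) *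
              (D + C * d + 2 * d * (z.1 + z.2))) := by gcongr
          _ = _ := by ring
    have hint : Integrable (fun z : ℝ × ℝ => s ^ j * Real.exp (α * M) *
        ((D + C * d) * Real.exp (α * (z.2 * r₀ - z.1 * q₀)) +
          2 * d * (Real.exp (α * (z.2 * r₀ - z.1 * q₀)) * (z.1 + z.2)))) ν :=
      ((hE.const_mul _).add (hK.const_mul _)).const_mul _
    refine (norm_integral_le_of_norm_le hint hpt).trans ?_
    rw [integral_const_mul, integral_add (hE.const_mul _) (hK.const_mul _), integral_const_mul,
      integral_const_mul, pow_succ, mul_assoc (s ^ j), mul_assoc (s ^ j), mul_left_comm s]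
    refine mul_le_mul_of_nonneg_left (mul_le_mul_of_nonneg_left ?_ (Real.exp_pos _).le)
      (by positivity)
    -- Each of the two pairs drifts apart by at most `d * (z.1 + z.2)` in one step, hence `2 * d *
    -- κ`; `hsC` is what allows `C` to absorb it.
    calc _ ≤ (D + C * d) * ρ' + 2 * d * κ := by gcongr
      _ = D * ρ' + d * (ρ' * C + 2 * κ) := by ring
      _ ≤ D * s + d * (s * C) := by gcongr
      _ = _ := by ring

/-- Halving the exponent costs a square root, by Cauchy–Schwarz. The other half is kept in reserve
to dominate polynomial factors and products. -/
lemma ExpDrift.integral_exp_half_le (h : ExpDrift ν q₀ r₀ β ε ρ) :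
    ∫ z : ℝ × ℝ, Real.exp (β / 2 * (z.2 * r₀ - z.1 * q₀)) ∂ν ≤ √ρ := by
  have hρ := Real.sqrt_pos.2 h.ρ_pos
  have hint : Integrable (fun z : ℝ × ℝ => (√ρ)⁻¹ / 2 *
      Real.exp (β * (z.2 * r₀) - (β - ε) * (z.1 * q₀)) + √ρ / 2) ν :=
    (h.integrable_exp.const_mul _).add (integrable_const _)
  calc _ ≤ ∫ z : ℝ × ℝ, ((√ρ)⁻¹ / 2 *
        Real.exp (β * (z.2 * r₀) - (β - ε) * (z.1 * q₀)) + √ρ / 2) ∂ν := by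
        refine integral_mono_ae h.integrable_exp_half hint ?_
        filter_upwards [h.nonneg] with z hz
        have h0 : 0 ≤ ε * (z.1 * q₀) := mul_nonneg h.ε_pos.le (mul_nonneg hz.1 h.q₀_pos.le)
        have h1 : Real.exp (β / 2 * (z.2 * r₀ - z.1 * q₀)) ^ 2 ≤
            Real.exp (β * (z.2 * r₀) - (β - ε) * (z.1 * q₀)) := by
          rw [← Real.exp_nat_mul]
          apply Real.exp_le_exp.2
          push_cast
          linarith
        set A := Real.exp (β / 2 * (z.2 * r₀ - z.1 * q₀))
        -- AM-GM with weight `√ρ` replaces Cauchy–Schwarz.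
        have h2 : A ≤ (√ρ)⁻¹ / 2 * A ^ 2 + √ρ / 2 := by
          have h3 : (√ρ)⁻¹ / 2 * A ^ 2 + √ρ / 2 - A = (√ρ)⁻¹ / 2 * (A - √ρ) ^ 2 := by
            field_simp; ring
          have h4 : 0 ≤ (√ρ)⁻¹ / 2 * (A - √ρ) ^ 2 := by positivity
          linarith
        exact h2.trans (by gcongr)
    _ = (√ρ)⁻¹ / 2 * ∫ z : ℝ × ℝ, Real.exp (β * (z.2 * r₀) - (β - ε) * (z.1 * q₀)) ∂ν
          + √ρ / 2 := by
        rw [integral_add (h.integrable_exp.const_mul _) (integrable_const _), integral_const_mul]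
        simp
    _ ≤ (√ρ)⁻¹ / 2 * ρ + √ρ / 2 := by
        have := h.integral_exp_le
        gcongr
    _ = √ρ := by
        nth_rewrite 2 [← Real.mul_self_sqrt h.ρ_pos.le]
        field_simp
        ring

lemma ExpDrift.exists_abs_meanWait_mixed_le (h : ExpDrift ν q₀ r₀ β ε ρ) :
    ∃ s C : ℝ, 0 < s ∧ s < 1 ∧ 0 ≤ C ∧ ∀ q r q' r' : ℝ, q₀ ≤ q → r ≤ r₀ → q₀ ≤ q' → r' ≤ r₀ →
      ∀ (j : ℕ) (a b a' b' M : ℝ), 0 ≤ M → a ≤ M → b ≤ M → a' ≤ M → b' ≤ M →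
      |meanWait ν j q r a - meanWait ν j q r b - meanWait ν j q' r' a' + meanWait ν j q' r' b'| ≤
      s ^ j * (Real.exp (β / 2 * M) *
        (|a - a'| + |b - b'| + C * (|q - q'| + |r - r'|))) := by
  have hρ := Real.sqrt_pos.2 h.ρ_pos
  have hρ1 : √ρ < 1 := (Real.sqrt_lt' one_pos).2 (by simpa using h.ρ_lt)
  set κ := ∫ z : ℝ × ℝ, Real.exp (β / 2 * (z.2 * r₀ - z.1 * q₀)) * (z.1 + z.2) ∂ν with hκ
  have hκ0 : 0 ≤ κ := by
    refine integral_nonneg_of_ae ?_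
    filter_upwards [h.nonneg] with z hz
    exact mul_nonneg (Real.exp_pos _).le (add_nonneg hz.1 hz.2)
  have hs : 0 < (1 - √ρ) / 2 := by linarith
  -- The rate is the midpoint of `√ρ` and 1, and the constant solves `√ρ * C + 2 * κ = s * C`.
  refine ⟨(1 + √ρ) / 2, 2 * κ / ((1 - √ρ) / 2), by linarith, by linarith, by positivity, ?_⟩
  intro q r q' r' hq hr hq' hr' j a b a' b' M hM ha hb ha' hb'
  refine h.abs_meanWait_mixed_le h.integrable_exp_half h.integral_exp_half_le
    h.integrable_exp_half_mul hκ.symm.le (by linarith [h.β_pos]) (by linarith) (by linarith)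
    (by positivity) (le_of_eq ?_) hq hr hq' hr' j a b a' b' M hM ha hb ha' hb'
  have : 1 - √ρ ≠ 0 := by linarith
  field_simp
  ring

/-- The increments of the mean waiting time in the number of steps are Lipschitz in the
parameters, with geometrically decaying constants. -/
lemma ExpDrift.exists_abs_meanWait_succ_sub_le (h : ExpDrift ν q₀ r₀ β ε ρ) :
    ∃ s C : ℝ, 0 < s ∧ s < 1 ∧ 0 ≤ C ∧ ∀ q r q' r' : ℝ, q₀ ≤ q → r ≤ r₀ → q₀ ≤ q' → r' ≤ r₀ →
      ∀ (j : ℕ) (w : ℝ), 0 ≤ w →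
      |(meanWait ν j q r w - meanWait ν j q' r' w) -
        (meanWait ν (j + 1) q r w - meanWait ν (j + 1) q' r' w)| ≤
        C * (|q - q'| + |r - r'|) * Real.exp (β / 2 * w) * s ^ j := by
  obtain ⟨s, C, hs0, hs1, hC, hmix⟩ := h.exists_abs_meanWait_mixed_le
  set κ := ∫ z : ℝ × ℝ, Real.exp (β / 2 * (z.2 * r₀)) * (1 + z.1 + z.2) ∂ν with hκ
  have hκ0 : 0 ≤ κ := by
    refine integral_nonneg_of_ae ?_
    filter_upwards [h.nonneg] with z hz
    exact mul_nonneg (Real.exp_pos _).le (by linarith [hz.1, hz.2])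
  refine ⟨s, (1 + C) * κ, hs0, hs1, by positivity, ?_⟩
  intro q r q' r' hq hr hq' hr' j w hw
  set d := |q - q'| + |r - r'| with hd
  have hd0 : 0 ≤ d := by positivity
  -- Conditioning on the first step turns the increment in `j` into an averaged mixed difference
  -- between `w` and its successor.
  have e1 : (meanWait ν j q r w - meanWait ν j q' r' w) -
        (meanWait ν (j + 1) q r w - meanWait ν (j + 1) q' r' w) =
      ∫ z, (meanWait ν j q r w - meanWait ν j q r (lindleyStep q r w z) - meanWait ν j q' r' w
        + meanWait ν j q' r' (lindleyStep q' r' w z)) ∂ν := by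
    rw [integral_sub_sub_add (integrable_const _) (h.integrable_meanWait j q r w)
      (integrable_const _) (h.integrable_meanWait j q' r' w)]
    simp only [meanWait, integral_const, probReal_univ, one_smul]
    ring
  rw [e1, ← Real.norm_eq_abs]
  have hint := h.integrable_weighted.const_mul ((1 + C) * d * Real.exp (β / 2 * w) * s ^ j)
  refine (norm_integral_le_of_norm_le hint ?_).trans (le_of_eq ?_)
  · filter_upwards [h.nonneg] with z hz
    rw [Real.norm_eq_abs]
    have hr0 := h.r₀_pos
    have hz1 : 0 ≤ z.1 * q₀ := mul_nonneg hz.1 h.q₀_pos.le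
    have hz2 : 0 ≤ z.2 * r₀ := mul_nonneg hz.2 hr0.le
    have hM : max (w + (z.2 * r₀ - z.1 * q₀)) 0 ≤ w + z.2 * r₀ :=
      max_le (by linarith) (by linarith)
    refine (hmix q r q' r' hq hr hq' hr' j w _ w _ (w + z.2 * r₀) (by linarith) (by linarith)
      ((lindleyStep_le hq hr le_rfl hz).trans hM) (by linarith)
      ((lindleyStep_le hq' hr' le_rfl hz).trans hM)).trans ?_
    have e2 := abs_lindleyStep_sub_le q r w q' r' w hz
    rw [sub_self, abs_zero, zero_add] at e2
    rw [sub_self, abs_zero, zero_add, mul_add (β / 2), Real.exp_add]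
    calc _ ≤ s ^ j * (Real.exp (β / 2 * w) * Real.exp (β / 2 * (z.2 * r₀)) *
          ((1 + C) * d * (1 + z.1 + z.2))) := by
          gcongr
          nlinarith [mul_nonneg hC hd0, mul_nonneg (mul_nonneg hC hd0) (add_nonneg hz.1 hz.2)]
      _ = _ := by ring
  · rw [integral_const_mul]; ring

/-- If the mean waiting times converge to `m`, then their distance to `m` is Lipschitz in the
parameters, with geometrically decaying constants. -/
lemma ExpDrift.exists_abs_meanWait_sub_limit_le (h : ExpDrift ν q₀ r₀ β ε ρ) :
    ∃ s C : ℝ, 0 < s ∧ s < 1 ∧ 0 ≤ C ∧ ∀ q r q' r' : ℝ, q₀ ≤ q → r ≤ r₀ → q₀ ≤ q' → r' ≤ r₀ →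
      ∀ (w l l' : ℝ), 0 ≤ w →
      Filter.Tendsto (fun n => meanWait ν n q r w) Filter.atTop (nhds l) →
      Filter.Tendsto (fun n => meanWait ν n q' r' w) Filter.atTop (nhds l') → ∀ j : ℕ,
      |(meanWait ν j q r w - l) - (meanWait ν j q' r' w - l')| ≤
        C * (|q - q'| + |r - r'|) * Real.exp (β / 2 * w) * s ^ j := by
  obtain ⟨s, C, hs0, hs1, hC, hb⟩ := h.exists_abs_meanWait_succ_sub_le
  -- The factor `1 / (1 - s)` comes from summing the geometric tail of the increments from `j` on.
  refine ⟨s, C / (1 - s), hs0, hs1, div_nonneg hC (by linarith), ?_⟩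
  intro q r q' r' hq hr hq' hr' w l l' hw hl hl' j
  have := dist_le_of_le_geometric_of_tendsto s
    (C * (|q - q'| + |r - r'|) * Real.exp (β / 2 * w)) hs1
    (fun n => by rw [Real.dist_eq]; exact hb q r q' r' hq hr hq' hr' n w hw) (hl.sub hl') j
  rw [Real.dist_eq] at this
  calc _ = |meanWait ν j q r w - meanWait ν j q' r' w - (l - l')| := by congr 1; ring
    _ ≤ _ := this
    _ = _ := by ring

end Drift

/-! ### Stationary distribution: uniqueness, existence, geometric convergence of the mean. -/

/-- One step of the pair (waiting time, observed busy period). -/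
noncomputable def busyStep (q r : ℝ) (x z : ℝ × ℝ) : ℝ × ℝ :=
  (lindleyStep q r x.1 z, if 0 < lindleyStep q r x.1 z then x.2 + z.1 * q else 0)

lemma measurable_busyStep (q r : ℝ) :
    Measurable (fun p : (ℝ × ℝ) × ℝ × ℝ => busyStep q r p.1 p.2) := by
  have h : Measurable (fun p : (ℝ × ℝ) × ℝ × ℝ => lindleyStep q r p.1.1 p.2) := by
    unfold lindleyStep; fun_prop
  exact h.prodMk (Measurable.ite (measurableSet_lt measurable_const h) (by fun_prop) (by fun_prop))

lemma measurable_busyStep_right (q r : ℝ) (x : ℝ × ℝ) : Measurable (busyStep q r x) :=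
  (measurable_busyStep q r).comp measurable_prodMk_left

lemma busyStep_eq_zero {q r : ℝ} {x z : ℝ × ℝ} (h : ¬ 0 < (busyStep q r x z).1) :
    busyStep q r x z = (0, 0) := by
  have h' : ¬ 0 < lindleyStep q r x.1 z := h
  have h0 : lindleyStep q r x.1 z = 0 := le_antisymm (not_lt.1 h') (lindleyStep_nonneg _ _ _ _)
  simp [busyStep, h0]

/-- The probability that the pair (waiting time, observed busy period) is in `A` after `n` steps. -/
noncomputable def busyProb (ν : Measure (ℝ × ℝ)) (q r : ℝ) (A : Set (ℝ × ℝ)) :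
    ℕ → ℝ × ℝ → ℝ
  | 0, x => A.indicator 1 x
  | n + 1, x => ∫ z, busyProb ν q r A n (busyStep q r x z) ∂ν

section Stationary

variable {ν : Measure (ℝ × ℝ)} {q₀ r₀ β ε ρ : ℝ}

lemma measurable_busyProb [IsProbabilityMeasure ν]
    (q r : ℝ) {A : Set (ℝ × ℝ)} (hA : MeasurableSet A) (n : ℕ) :
    Measurable (busyProb ν q r A n) := by
  induction n with
  | zero => exact measurable_one.indicator hA
  | succ n ih =>
    have h : Measurable (fun p : (ℝ × ℝ) × ℝ × ℝ =>
        busyProb ν q r A n (busyStep q r p.1 p.2)) := ih.comp (measurable_busyStep q r)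
    exact (h.stronglyMeasurable.integral_prod_right' (ν := ν)).measurable

lemma abs_busyProb_le [IsProbabilityMeasure ν] (q r : ℝ) (A : Set (ℝ × ℝ)) (n : ℕ) (x : ℝ × ℝ) :
    |busyProb ν q r A n x| ≤ 1 := by
  induction n generalizing x with
  | zero =>
    simp only [busyProb, indicator]
    split_ifs <;> simp
  | succ n ih =>
    simp only [busyProb]
    rw [← Real.norm_eq_abs]
    refine (norm_integral_le_of_norm_le_const (C := 1)
      (Filter.Eventually.of_forall fun z => ?_)).trans ?_
    · exact ih _
    · simp

lemma integrable_busyProb [IsProbabilityMeasure ν]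
    {X : Type*} [MeasurableSpace X] {π : Measure X} [IsFiniteMeasure π]
    (q r : ℝ) {A : Set (ℝ × ℝ)} (hA : MeasurableSet A) (n : ℕ) {g : X → ℝ × ℝ}
    (hg : Measurable g) : Integrable (fun x => busyProb ν q r A n (g x)) π :=
  Integrable.of_bound (C := 1) ((measurable_busyProb q r hA n).comp hg).aestronglyMeasurable
    (Filter.Eventually.of_forall fun x => abs_busyProb_le q r A n (g x))

/-- An empty queue also resets the busy period, so two copies with common inputs merge at (0, 0)
once the bound `m` on both waiting times is pushed to 0. No bound on the busy periods is needed. -/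
lemma ExpDrift.abs_busyProb_sub_le [IsProbabilityMeasure ν]
    (h : ExpDrift ν q₀ r₀ β ε ρ) {q r : ℝ} (hq : q₀ ≤ q)
    (hr : r ≤ r₀) {A : Set (ℝ × ℝ)} (hA : MeasurableSet A) (n : ℕ) (x x' : ℝ × ℝ) (m : ℝ)
    (hm : 0 ≤ m) (hx : x.1 ≤ m) (hx' : x'.1 ≤ m) :
    |busyProb ν q r A n x - busyProb ν q r A n x'| ≤ √ρ ^ n * Real.exp (β / 2 * m) := by
  have hβ := h.β_pos
  induction n generalizing x x' m with
  | zero =>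
    have h1 : (1 : ℝ) ≤ Real.exp (β / 2 * m) := Real.one_le_exp (by positivity)
    simp only [busyProb, indicator, pow_zero, one_mul]
    split_ifs <;> simp only [Pi.one_apply, sub_self, sub_zero, zero_sub, abs_neg, abs_zero,
      abs_one] <;>
      linarith
  | succ n ih =>
    simp only [busyProb]
    rw [← integral_sub (integrable_busyProb q r hA n (measurable_busyStep_right q r x))
      (integrable_busyProb q r hA n (measurable_busyStep_right q r x')), ← Real.norm_eq_abs]
    have hint := h.integrable_exp_half.const_mul (√ρ ^ n * Real.exp (β / 2 * m))
    refine (norm_integral_le_of_norm_le hint ?_).trans ?_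
    · filter_upwards [h.nonneg] with z hz
      rw [Real.norm_eq_abs]
      have l := lindleyStep_le hq hr hx hz
      have l' := lindleyStep_le hq hr hx' hz
      rcases le_or_gt (m + (z.2 * r₀ - z.1 * q₀)) 0 with hle | hlt
      · rw [max_eq_right hle] at l l'
        rw [busyStep_eq_zero (not_lt.2 l), busyStep_eq_zero (not_lt.2 l'), sub_self, abs_zero]
        positivity
      · rw [max_eq_left hlt.le] at l l'
        refine (ih _ _ _ hlt.le l l').trans (le_of_eq ?_)
        rw [mul_add (β / 2), Real.exp_add]
        ring
    · rw [integral_const_mul, pow_succ, mul_assoc, mul_assoc, mul_comm (√ρ)]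
      have := h.integral_exp_half_le
      gcongr

variable {q r : ℝ} {π : Measure (ℝ × ℝ)}

lemma integrable_comp_of_invariant {T : (ℝ × ℝ) × ℝ × ℝ → ℝ × ℝ} (hT : Measurable T)
    (hinv : (π.prod ν).map T = π) {F : ℝ × ℝ → ℝ} (hF : Integrable F π) :
    Integrable (fun p => F (T p)) (π.prod ν) := by
  rw [← hinv] at hF
  exact hF.comp_measurable hT

lemma integral_integral_of_invariant [IsProbabilityMeasure ν]
    [SFinite π] {T : (ℝ × ℝ) × ℝ × ℝ → ℝ × ℝ}
    (hT : Measurable T) (hinv : (π.prod ν).map T = π) {F : ℝ × ℝ → ℝ} (hF : Integrable F π) :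
    ∫ x, ∫ z, F (T (x, z)) ∂ν ∂π = ∫ x, F x ∂π := by
  rw [← integral_prod _ (integrable_comp_of_invariant hT hinv hF)]
  conv_rhs => rw [← hinv]
  rw [integral_map hT.aemeasurable]
  rw [hinv]
  exact hF.1

lemma integral_busyProb [IsProbabilityMeasure ν] [IsProbabilityMeasure π]
    (hinv : (π.prod ν).map (fun p => busyStep q r p.1 p.2) = π) {A : Set (ℝ × ℝ)}
    (hA : MeasurableSet A) (n : ℕ) : ∫ x, busyProb ν q r A n x ∂π = π.real A := by
  induction n with
  | zero =>
    simp only [busyProb]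
    exact integral_indicator_one hA
  | succ n ih =>
    rw [← ih]
    exact integral_integral_of_invariant (measurable_busyStep q r) hinv
      (integrable_busyProb q r hA n measurable_id)

/-- The chain (waiting time, observed busy period) has at most one stationary distribution. -/
lemma ExpDrift.stationary_unique [IsProbabilityMeasure ν]
    (h : ExpDrift ν q₀ r₀ β ε ρ) (hq : q₀ ≤ q) (hr : r ≤ r₀)
    {π' : Measure (ℝ × ℝ)} [IsProbabilityMeasure π] [IsProbabilityMeasure π']
    (hn : ∀ᵐ x ∂π, 0 ≤ x.1 ∧ 0 ≤ x.2) (hn' : ∀ᵐ x ∂π', 0 ≤ x.1 ∧ 0 ≤ x.2)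
    (hinv : (π.prod ν).map (fun p => busyStep q r p.1 p.2) = π)
    (hinv' : (π'.prod ν).map (fun p => busyStep q r p.1 p.2) = π') : π = π' := by
  have hρ1 : √ρ < 1 := (Real.sqrt_lt' one_pos).2 (by simpa using h.ρ_lt)
  ext A hA
  rw [← measureReal_eq_measureReal_iff]
  have hconst : ∀ n, ∫ x, (busyProb ν q r A n x.1 - busyProb ν q r A n x.2) ∂(π.prod π') =
      π.real A - π'.real A := fun n => by
    rw [integral_sub (integrable_busyProb q r hA n measurable_fst)
      (integrable_busyProb q r hA n measurable_snd), integral_fun_fst (μ := π) (ν := π'),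
      integral_fun_snd (μ := π) (ν := π'), integral_busyProb hinv hA, integral_busyProb hinv' hA]
    simp
  have hlim : Filter.Tendsto
      (fun n => ∫ x, (busyProb ν q r A n x.1 - busyProb ν q r A n x.2) ∂(π.prod π'))
      Filter.atTop (nhds (∫ _, (0 : ℝ) ∂(π.prod π'))) := by
    -- The geometric bound is only pointwise in the two initial states, and no exponential moment of
    -- `π` or `π'` is assumed; boundedness of probabilities gives the domination.
    refine tendsto_integral_of_dominated_convergence (fun _ => 2) (fun n => ?_)
      (integrable_const _) (fun n => Filter.Eventually.of_forall fun x => ?_) ?_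
    · exact ((integrable_busyProb q r hA n measurable_fst).sub
        (integrable_busyProb q r hA n measurable_snd)).1
    · have h1 := abs_sub (busyProb ν q r A n x.1) (busyProb ν q r A n x.2)
      have h2 := abs_busyProb_le (ν := ν) q r A n x.1
      have h3 := abs_busyProb_le (ν := ν) q r A n x.2
      rw [Real.norm_eq_abs]
      linarith
    · have g1 := (Measure.quasiMeasurePreserving_fst (μ := π) (ν := π')).ae hn
      have g2 := (Measure.quasiMeasurePreserving_snd (μ := π) (ν := π')).ae hn'
      filter_upwards [g1, g2] with x h1 h2
      refine squeeze_zero_norm (fun n => h.abs_busyProb_sub_le hq hr hA n x.1 x.2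
        (x.1.1 + x.2.1) (add_nonneg h1.1 h2.1) (by linarith [h2.1]) (by linarith [h1.1])) ?_
      simpa using (tendsto_pow_atTop_nhds_zero_of_lt_one (Real.sqrt_nonneg ρ) hρ1).mul_const
        (Real.exp (β / 2 * (x.1.1 + x.2.1)))
  simp only [hconst, integral_zero] at hlim
  exact sub_eq_zero.1 (tendsto_nhds_unique tendsto_const_nhds hlim)

lemma ExpDrift.lintegral_exp_le (h : ExpDrift ν q₀ r₀ β ε ρ) :
    ∫⁻ z : ℝ × ℝ, ENNReal.ofReal (Real.exp (β * (z.2 * r₀ - z.1 * q₀))) ∂ν ≤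
      ENNReal.ofReal ρ := by
  calc _ ≤ ∫⁻ z : ℝ × ℝ,
        ENNReal.ofReal (Real.exp (β * (z.2 * r₀) - (β - ε) * (z.1 * q₀))) ∂ν := by
        refine lintegral_mono_ae ?_
        filter_upwards [h.nonneg] with z hz
        have h0 : 0 ≤ ε * (z.1 * q₀) := mul_nonneg h.ε_pos.le (mul_nonneg hz.1 h.q₀_pos.le)
        refine ENNReal.ofReal_le_ofReal (Real.exp_le_exp.2 (by linarith))
    _ ≤ _ := by
        rw [← ofReal_integral_eq_lintegral_ofReal h.integrable_exp
          (Filter.Eventually.of_forall fun z => (Real.exp_pos _).le)]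
        exact ENNReal.ofReal_le_ofReal h.integral_exp_le

/-- The law at time `n` of the pair (waiting time, observed busy period), started from `(0, 0)`,
on the event that the queue has not been empty at any of the times `1, …, n`. -/
noncomputable def tabooLaw (ν : Measure (ℝ × ℝ)) (q r : ℝ) : ℕ → Measure (ℝ × ℝ)
  | 0 => Measure.dirac (0, 0)
  | n + 1 => (((tabooLaw ν q r n).prod ν).map (fun p => busyStep q r p.1 p.2)).restrict
      {x | 0 < x.1}

instance isFiniteMeasure_tabooLaw [IsProbabilityMeasure ν]
    (q r : ℝ) (n : ℕ) : IsFiniteMeasure (tabooLaw ν q r n) := by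
  induction n with
  | zero => rw [tabooLaw]; infer_instance
  | succ n ih => rw [tabooLaw]; infer_instance

/-- On the event of staying positive the truncation at 0 is inactive, so each step multiplies the
exponential moment by at most `ρ`. -/
lemma ExpDrift.lintegral_tabooLaw_le [IsProbabilityMeasure ν]
    (h : ExpDrift ν q₀ r₀ β ε ρ) (hq : q₀ ≤ q) (hr : r ≤ r₀)
    (n : ℕ) : ∫⁻ x, ENNReal.ofReal (Real.exp (β * x.1)) ∂(tabooLaw ν q r n) ≤
      ENNReal.ofReal ρ ^ n := by
  have hms : MeasurableSet {x : ℝ × ℝ | 0 < x.1} := measurableSet_lt measurable_const measurable_fst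
  induction n with
  | zero => simp [tabooLaw]
  | succ n ih =>
    rw [tabooLaw, setLIntegral_map hms (by fun_prop) (measurable_busyStep q r),
      ← lintegral_indicator (measurable_busyStep q r hms)]
    calc _ ≤ ∫⁻ p, ENNReal.ofReal (Real.exp (β * p.1.1)) *
          ENNReal.ofReal (Real.exp (β * (p.2.2 * r₀ - p.2.1 * q₀)))
            ∂((tabooLaw ν q r n).prod ν) := by
          refine lintegral_mono_ae ?_
          filter_upwards [(Measure.quasiMeasurePreserving_snd (μ := tabooLaw ν q r n)).ae h.nonneg]
            with p hp
          refine indicator_apply_le' (fun hpos => ?_) (fun _ => zero_le)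
          have l := lindleyStep_le hq hr (le_refl p.1.1) hp
          have hpos' : 0 < lindleyStep q r p.1.1 p.2 := hpos
          have l2 : lindleyStep q r p.1.1 p.2 ≤ p.1.1 + (p.2.2 * r₀ - p.2.1 * q₀) := by
            rcases le_max_iff.1 l with h1 | h1
            · exact h1
            · exact absurd h1 (not_le.2 hpos')
          rw [← ENNReal.ofReal_mul (Real.exp_pos _).le, ← Real.exp_add, ← mul_add]
          have := h.β_pos
          refine ENNReal.ofReal_le_ofReal (Real.exp_le_exp.2 ?_)
          exact mul_le_mul_of_nonneg_left l2 this.le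
      _ = (∫⁻ x, ENNReal.ofReal (Real.exp (β * x.1)) ∂(tabooLaw ν q r n)) *
          ∫⁻ z : ℝ × ℝ, ENNReal.ofReal (Real.exp (β * (z.2 * r₀ - z.1 * q₀))) ∂ν :=
          lintegral_prod_mul (f := fun x : ℝ × ℝ => ENNReal.ofReal (Real.exp (β * x.1)))
            (g := fun z : ℝ × ℝ => ENNReal.ofReal (Real.exp (β * (z.2 * r₀ - z.1 * q₀))))
            (by fun_prop) (by fun_prop)
      _ ≤ _ := by rw [pow_succ]; exact mul_le_mul' ih h.lintegral_exp_le

lemma ExpDrift.ae_nonneg_tabooLaw (h : ExpDrift ν q₀ r₀ β ε ρ) (hq : q₀ ≤ q) (n : ℕ) :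
    ∀ᵐ x ∂(tabooLaw ν q r n), 0 ≤ x.1 ∧ 0 ≤ x.2 := by
  have hms : MeasurableSet {x : ℝ × ℝ | 0 ≤ x.1 ∧ 0 ≤ x.2} :=
    (measurableSet_le measurable_const measurable_fst).inter
      (measurableSet_le measurable_const measurable_snd)
  induction n with
  | zero => rw [tabooLaw, ae_dirac_iff hms]; simp
  | succ n ih =>
    rw [tabooLaw]
    refine ae_restrict_of_ae ?_
    rw [ae_map_iff (measurable_busyStep q r).aemeasurable hms]
    filter_upwards [(Measure.quasiMeasurePreserving_snd (μ := tabooLaw ν q r n)).ae h.nonneg,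
      (Measure.quasiMeasurePreserving_fst (ν := ν)).ae ih] with p hp hx
    refine ⟨lindleyStep_nonneg _ _ _ _, ?_⟩
    have := mul_nonneg hp.1 (h.q₀_pos.le.trans hq)
    simp only [busyStep]
    split_ifs
    · linarith [hx.2]
    · exact le_rfl

/-- Mass leaving the positive states lands entirely at (0, 0); this closes the cycle in the
invariance proof. -/
lemma tabooLaw_compl_apply (q r : ℝ) (n : ℕ) (A : Set (ℝ × ℝ)) (hA : MeasurableSet A) :
    (((tabooLaw ν q r n).prod ν).map (fun p => busyStep q r p.1 p.2)).restrict
      {x | 0 < x.1}ᶜ A = (((tabooLaw ν q r n).prod ν).map (fun p => busyStep q r p.1 p.2)).restrict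
      {x | 0 < x.1}ᶜ univ * Measure.dirac (0, 0) A := by
  have hms : MeasurableSet {x : ℝ × ℝ | 0 < x.1} := measurableSet_lt measurable_const measurable_fst
  have key : ∀ B, MeasurableSet B → (((tabooLaw ν q r n).prod ν).map
      (fun p => busyStep q r p.1 p.2)).restrict {x | 0 < x.1}ᶜ B =
      ((tabooLaw ν q r n).prod ν) ((fun p => busyStep q r p.1 p.2) ⁻¹' (B ∩ {x | 0 < x.1}ᶜ)) :=
    fun B hB => by
      rw [Measure.restrict_apply hB, Measure.map_apply (measurable_busyStep q r)
        (hB.inter hms.compl)]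
  rw [key A hA, key univ MeasurableSet.univ, Measure.dirac_apply' _ hA]
  by_cases h0 : ((0, 0) : ℝ × ℝ) ∈ A
  · simp only [h0, indicator_of_mem, Pi.one_apply, mul_one]
    congr 1
    ext p
    simp only [mem_preimage, mem_inter_iff, mem_compl_iff, mem_ofPred_eq, mem_univ, true_and,
      and_iff_right_iff_imp]
    intro hp
    rw [busyStep_eq_zero hp]
    exact h0
  · simp only [h0, not_false_eq_true, indicator_of_notMem, mul_zero]
    convert measure_empty (μ := (tabooLaw ν q r n).prod ν)
    ext p
    simp only [mem_preimage, mem_inter_iff, mem_compl_iff, mem_ofPred_eq, mem_empty_iff_false,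
      iff_false, not_and, not_not]
    intro hp
    by_contra hc
    rw [busyStep_eq_zero hc] at hp
    exact h0 hp

/-- The chain (waiting time, observed busy period) has a stationary distribution with exponential
moments of the waiting time: the normalized occupation measure of a cycle. -/
lemma ExpDrift.exists_stationary [IsProbabilityMeasure ν]
    (h : ExpDrift ν q₀ r₀ β ε ρ) (hq : q₀ ≤ q) (hr : r ≤ r₀) :
    ∃ π : Measure (ℝ × ℝ), IsProbabilityMeasure π ∧ (∀ᵐ x ∂π, 0 ≤ x.1 ∧ 0 ≤ x.2) ∧
      (π.prod ν).map (fun p => busyStep q r p.1 p.2) = π ∧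
      Integrable (fun x => Real.exp (β * x.1)) π := by
  have hms : MeasurableSet {x : ℝ × ℝ | 0 < x.1} := measurableSet_lt measurable_const measurable_fst
  set σ := Measure.sum (tabooLaw ν q r) with hσ
  have hexp : ∫⁻ x, ENNReal.ofReal (Real.exp (β * x.1)) ∂σ < ⊤ := by
    rw [hσ, lintegral_sum_measure]
    refine (ENNReal.tsum_le_tsum fun n => h.lintegral_tabooLaw_le hq hr n).trans_lt ?_
    rw [ENNReal.tsum_geometric, ENNReal.inv_lt_top, tsub_pos_iff_lt]
    exact ENNReal.ofReal_lt_one.2 h.ρ_lt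
  have hnn : ∀ᵐ x ∂σ, 0 ≤ x.1 ∧ 0 ≤ x.2 :=
    Measure.ae_sum_iff.2 fun n => h.ae_nonneg_tabooLaw hq n
  have hfin : σ univ < ⊤ := by
    refine lt_of_le_of_lt ?_ hexp
    rw [← lintegral_one]
    refine lintegral_mono_ae ?_
    filter_upwards [hnn] with x hx
    rw [← ENNReal.ofReal_one]
    exact ENNReal.ofReal_le_ofReal (Real.one_le_exp (mul_nonneg h.β_pos.le hx.1))
  have : IsFiniteMeasure σ := ⟨hfin⟩
  have hne : σ univ ≠ 0 := by
    have : tabooLaw ν q r 0 univ ≤ σ univ := Measure.le_sum_apply _ _ |>.trans' (by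
      exact ENNReal.le_tsum (f := fun n => tabooLaw ν q r n univ) 0)
    simp only [tabooLaw, measure_univ] at this
    exact (zero_lt_one.trans_le this).ne'
  set c := ∑' n, (((tabooLaw ν q r n).prod ν).map (fun p => busyStep q r p.1 p.2)).restrict
      {x | 0 < x.1}ᶜ univ with hc
  have hmap : ∀ A, MeasurableSet A → (σ.prod ν).map (fun p => busyStep q r p.1 p.2) A =
      ∑' n, tabooLaw ν q r (n + 1) A + c * Measure.dirac (0, 0) A := fun A hA => by
    rw [hσ, Measure.prod_sum_left, Measure.map_sum (measurable_busyStep q r).aemeasurable,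
      Measure.sum_apply _ hA, hc, ← ENNReal.tsum_mul_right, ← ENNReal.tsum_add]
    refine tsum_congr fun n => ?_
    rw [← tabooLaw_compl_apply q r n A hA, tabooLaw, ← Measure.add_apply,
      Measure.restrict_add_restrict_compl hms]
  have hσA : ∀ A, MeasurableSet A → σ A =
      ∑' n, tabooLaw ν q r (n + 1) A + Measure.dirac (0, 0) A := fun A hA => by
    rw [hσ, Measure.sum_apply _ hA, tsum_eq_zero_add' ENNReal.summable, add_comm, tabooLaw]
  -- `c` is the probability of ever returning to the empty state. It equals 1 by mass balance: a
  -- step preserves the total mass of `σ`, which is finite, so the returning mass must replace the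
  -- unit mass at time 0.
  have hc1 : c = 1 := by
    have h1 := hmap univ MeasurableSet.univ
    have h2 := hσA univ MeasurableSet.univ
    rw [Measure.map_apply (measurable_busyStep q r) MeasurableSet.univ, preimage_univ,
      ← univ_prod_univ, Measure.prod_prod, measure_univ (μ := ν), mul_one, h2] at h1
    simp only [measure_univ, mul_one] at h1
    refine ((ENNReal.add_right_inj ?_).1 h1).symm
    intro htop
    rw [htop, top_add] at h2
    exact hfin.ne h2
  have hinv : (σ.prod ν).map (fun p => busyStep q r p.1 p.2) = σ := by
    ext A hA
    rw [hmap A hA, hσA A hA, hc1, one_mul]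
  refine ⟨(σ univ)⁻¹ • σ, ⟨?_⟩, ?_, ?_, ?_⟩
  · rw [Measure.smul_apply, smul_eq_mul, ENNReal.inv_mul_cancel hne hfin.ne]
  · exact Measure.ae_smul_measure hnn _
  · rw [Measure.prod_smul_left, Measure.map_smul, hinv]
  · have : Integrable (fun x : ℝ × ℝ => Real.exp (β * x.1)) σ := by
      refine ⟨by fun_prop, ?_⟩
      rw [hasFiniteIntegral_iff_ofReal (Filter.Eventually.of_forall fun x => (Real.exp_pos _).le)]
      exact hexp
    exact this.smul_measure (ENNReal.inv_ne_top.2 hne)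

lemma ExpDrift.integrable_fst_of_exp (h : ExpDrift ν q₀ r₀ β ε ρ)
    (hn : ∀ᵐ x ∂π, 0 ≤ x.1 ∧ 0 ≤ x.2) (hexp : Integrable (fun x => Real.exp (β * x.1)) π) :
    Integrable (fun x : ℝ × ℝ => x.1) π := by
  have := h.β_pos
  refine (hexp.const_mul β⁻¹).mono' (by fun_prop) ?_
  filter_upwards [hn] with x hx
  rw [Real.norm_eq_abs, abs_of_nonneg hx.1, le_inv_mul_iff₀ this]
  linarith [Real.add_one_le_exp (β * x.1)]

lemma ExpDrift.integral_meanWait [IsProbabilityMeasure ν]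
    (h : ExpDrift ν q₀ r₀ β ε ρ) [IsProbabilityMeasure π]
    (hi : Integrable (fun x : ℝ × ℝ => x.1) π)
    (hinv : (π.prod ν).map (fun p => busyStep q r p.1 p.2) = π) (n : ℕ) :
    ∫ x, meanWait ν n q r x.1 ∂π = ∫ x, x.1 ∂π := by
  induction n with
  | zero => simp [meanWait]
  | succ n ih =>
    rw [← ih]
    exact integral_integral_of_invariant (measurable_busyStep q r) hinv
      (F := fun x => meanWait ν n q r x.1) (integrable_of_abs_sub_le
        (measurable_meanWait_right ν n q r) (h.abs_meanWait_sub_le n q r) hi)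

/-- The mean waiting times converge geometrically to the stationary mean waiting time. -/
lemma ExpDrift.exists_abs_meanWait_sub_stationary_le [IsProbabilityMeasure ν]
    (h : ExpDrift ν q₀ r₀ β ε ρ) :
    ∃ s : ℝ, 0 < s ∧ s < 1 ∧ ∀ (q r : ℝ) (π : Measure (ℝ × ℝ)), q₀ ≤ q → r ≤ r₀ →
      IsProbabilityMeasure π → (∀ᵐ x ∂π, 0 ≤ x.1 ∧ 0 ≤ x.2) →
      (π.prod ν).map (fun p => busyStep q r p.1 p.2) = π →
      Integrable (fun x => Real.exp (β * x.1)) π → ∀ w, 0 ≤ w → ∃ K : ℝ, ∀ n : ℕ,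
      |meanWait ν n q r w - ∫ x, x.1 ∂π| ≤ K * s ^ n := by
  obtain ⟨s, C, hs0, hs1, -, hmix⟩ := h.exists_abs_meanWait_mixed_le
  refine ⟨s, hs0, hs1, ?_⟩
  intro q r π hq hr _ hn hinv hexp w hw
  have hβ := h.β_pos
  have hi := h.integrable_fst_of_exp hn hexp
  have hdom : Integrable (fun x : ℝ × ℝ => Real.exp (β / 2 * (w + x.1)) * (w + x.1)) π := by
    refine (hexp.const_mul ((β / 2)⁻¹ * Real.exp (β * w))).mono' (by fun_prop) ?_
    filter_upwards [hn] with x hx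
    have hwx : 0 ≤ w + x.1 := add_nonneg hw hx.1
    rw [Real.norm_eq_abs, abs_of_nonneg (by positivity), mul_assoc, ← Real.exp_add,
      le_inv_mul_iff₀ (by positivity)]
    calc _ = Real.exp (β / 2 * (w + x.1)) * (β / 2 * (w + x.1)) := by ring
      _ ≤ Real.exp (β / 2 * (w + x.1)) * Real.exp (β / 2 * (w + x.1)) := by
          gcongr; linarith [Real.add_one_le_exp (β / 2 * (w + x.1))]
      _ = _ := by rw [← Real.exp_add]; congr 1; ring
  refine ⟨∫ x, Real.exp (β / 2 * (w + x.1)) * (w + x.1) ∂π, fun n => ?_⟩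
  have hin : Integrable (fun x : ℝ × ℝ => meanWait ν n q r x.1) π :=
    integrable_of_abs_sub_le (measurable_meanWait_right ν n q r) (h.abs_meanWait_sub_le n q r) hi
  have e : meanWait ν n q r w - ∫ x, x.1 ∂π =
      ∫ x, (meanWait ν n q r w - meanWait ν n q r x.1) ∂π := by
    rw [integral_sub (integrable_const _) hin, h.integral_meanWait hi hinv]
    simp
  rw [e, ← Real.norm_eq_abs, mul_comm, ← integral_const_mul]
  refine norm_integral_le_of_norm_le (hdom.const_mul _) ?_
  filter_upwards [hn] with x hx
  -- With equal parameters and `a' = b' = 0` the mixed difference is an ordinary difference in the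
  -- initial state.
  have := hmix q r q r hq hr hq hr n w x.1 0 0 (w + x.1) (add_nonneg hw hx.1)
    (by linarith [hx.1]) (by linarith) (add_nonneg hw hx.1) (add_nonneg hw hx.1)
  simpa [abs_of_nonneg hw, abs_of_nonneg hx.1] using this

end Stationary

/-! ### Elementary estimates, and integration against an independent input. -/

lemma one_add_le_mul_exp {ε t : ℝ} (hε : 0 < ε) (ht : 0 ≤ t) :
    1 + t ≤ (1 + 2 / ε) * Real.exp (ε / 2 * t) := by
  have h1 : 1 ≤ Real.exp (ε / 2 * t) := Real.one_le_exp (by positivity)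
  have h2 : t ≤ 2 / ε * Real.exp (ε / 2 * t) := by
    have h3 := Real.add_one_le_exp (ε / 2 * t)
    calc t = 2 / ε * (ε / 2 * t) := by field_simp
      _ ≤ _ := by gcongr; linarith
  linarith

lemma one_add_sq_le_exp {ε t : ℝ} (hε : 0 < ε) (ht : 0 ≤ t) :
    (1 + t) ^ 2 ≤ (1 + 2 / ε) ^ 2 * Real.exp (ε * t) := by
  calc (1 + t) ^ 2 ≤ ((1 + 2 / ε) * Real.exp (ε / 2 * t)) ^ 2 := by
        gcongr
        exact one_add_le_mul_exp hε ht
    _ = _ := by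
        rw [mul_pow, ← Real.exp_nat_mul]
        congr 2
        push_cast
        ring

/-- The convolution of a geometric sequence with the harmonic sequence is of harmonic order. -/
lemma exists_geometric_conv_harmonic_le {s s' K C : ℝ} (hs0 : 0 < s) (hs1 : s < 1) (hs0' : 0 < s')
    (hs1' : s' < 1) (hK : 0 ≤ K) (hC : 0 ≤ C) : ∃ B : ℝ, ∀ n : ℕ,
    K * s' ^ n + ∑ i ∈ Finset.range n, C * s ^ (n - 1 - i) / ((i : ℝ) + 1) ≤ B / ((n : ℝ) + 1) := by
  have sum' : ∀ x : ℝ, 0 < x → x < 1 → Summable (fun k : ℕ => ((k : ℝ) + 2) * x ^ k) :=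
    fun x h0 h1 => by
      have e1 := summable_pow_mul_geometric_of_norm_lt_one 1
        (show ‖x‖ < 1 by rwa [Real.norm_eq_abs, abs_of_pos h0])
      have e2 := (summable_geometric_of_lt_one h0.le h1).mul_left 2
      refine (e1.add e2).congr fun k => ?_
      ring
  refine ⟨K * ∑' k : ℕ, ((k : ℝ) + 2) * s' ^ k + C * ∑' k : ℕ, ((k : ℝ) + 2) * s ^ k, fun n => ?_⟩
  rw [le_div_iff₀ (by positivity), add_mul]
  refine add_le_add ?_ ?_
  · rw [mul_assoc]
    refine mul_le_mul_of_nonneg_left ?_ hK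
    refine le_trans ?_ ((sum' s' hs0' hs1').le_tsum n fun i _ => by positivity)
    rw [mul_comm]
    gcongr
    norm_num
  · rw [Finset.sum_mul, ← Finset.sum_range_reflect]
    refine le_trans ?_ (mul_le_mul_of_nonneg_left
      ((sum' s hs0 hs1).sum_le_tsum (Finset.range n) fun i _ => by positivity) hC)
    rw [Finset.mul_sum]
    refine Finset.sum_le_sum fun i hi => ?_
    have hin : i < n := Finset.mem_range.1 hi
    have e1 : n - 1 - (n - 1 - i) = i := by omega
    obtain ⟨j, rfl⟩ : ∃ j, n = i + j + 1 := ⟨n - i - 1, by omega⟩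
    have e2 : i + j + 1 - 1 - i = j := by omega
    rw [e1, e2]
    push_cast
    -- After the reflection `i` is the geometric exponent and `j + 1` the harmonic denominator. This
    -- inequality trades `n + 1` for that denominator at the price of the summable weight `i + 2`.
    have h1 : ((i : ℝ) + j + 1 + 1) ≤ (i + 2) * (j + 1) := by
      have : (0 : ℝ) ≤ i * j := by positivity
      nlinarith [(Nat.cast_nonneg j : (0 : ℝ) ≤ j)]
    rw [div_mul_eq_mul_div, div_le_iff₀ (by positivity)]
    calc C * s ^ i * (i + j + 1 + 1) ≤ C * s ^ i * ((i + 2) * (j + 1)) := by gcongr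
      _ = _ := by ring

lemma ProbabilityTheory.IndepFun.integral_comp_prodMk {Ω S T : Type*} [MeasurableSpace Ω]
    [MeasurableSpace S] [MeasurableSpace T] {P : Measure Ω} [IsProbabilityMeasure P]
    {X : Ω → S} {Z : Ω → T} (hind : IndepFun X Z P) (hX : Measurable X) (hZ : Measurable Z)
    {ν : Measure T} (hν : P.map Z = ν) {F : S × T → ℝ} (hF : Measurable F)
    (hint : Integrable (fun ω => F (X ω, Z ω)) P) :
    ∫ ω, F (X ω, Z ω) ∂P = ∫ ω, ∫ z, F (X ω, z) ∂ν ∂P := by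
  have hp : P.map (fun ω => (X ω, Z ω)) = (P.map X).prod ν := by
    rw [← hν]
    exact (indepFun_iff_map_prod_eq_prod_map_map hX.aemeasurable hZ.aemeasurable).1 hind
  have : IsProbabilityMeasure (P.map X) := Measure.isProbabilityMeasure_map hX.aemeasurable
  have : IsProbabilityMeasure ν := hν ▸ Measure.isProbabilityMeasure_map hZ.aemeasurable
  have hXZ := hX.prodMk hZ
  have hint' : Integrable F ((P.map X).prod ν) := by
    rw [← hp]
    exact (integrable_map_measure hF.aestronglyMeasurable hXZ.aemeasurable).2 hint
  rw [← integral_map (φ := fun ω => (X ω, Z ω)) hXZ.aemeasurable hF.aestronglyMeasurable, hp,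
    integral_prod _ hint', integral_map hX.aemeasurable]
  exact (hF.stronglyMeasurable.integral_prod_right' (ν := ν)).aestronglyMeasurable

/-! ### Queues with adaptive parameters: moments and tracking error. -/

/-- A queue with initially empty system whose scaling factors `q n`, `r n` are chosen
nonanticipatively, with steps of order `1 / n` relative to the size of the state. -/
structure AdaptiveQueue {Ω : Type*} [MeasurableSpace Ω] (P : Measure Ω) (ν : Measure (ℝ × ℝ))
    (q₀ r₀ D K : ℝ) (q r w y : ℕ → Ω → ℝ) (Z : ℕ → Ω → ℝ × ℝ) : Prop where
  measurable_q : ∀ n, Measurable (q n)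
  measurable_r : ∀ n, Measurable (r n)
  measurable_w : ∀ n, Measurable (w n)
  measurable_y : ∀ n, Measurable (y n)
  measurable_Z : ∀ n, Measurable (Z n)
  le_q : ∀ n ω, q₀ ≤ q n ω
  r_le : ∀ n ω, r n ω ≤ r₀
  indep : ∀ n, IndepFun (fun ω => (q n ω, r n ω, w n ω, y n ω)) (Z n) P
  law : ∀ n, P.map (Z n) = ν
  step : ∀ n ω, (w (n + 1) ω, y (n + 1) ω) = busyStep (q n ω) (r n ω) (w n ω, y n ω) (Z n ω)
  w_zero : ∀ ω, w 0 ω = 0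
  y_zero : ∀ ω, y 0 ω = 0
  bounded : ∀ n ω ω', |q n ω - q 0 ω'| + |r n ω - r 0 ω'| ≤ D
  drift : ∀ n, ∀ᵐ ω ∂P, |q (n + 1) ω - q n ω| + |r (n + 1) ω - r n ω| ≤
    K / ((n : ℝ) + 1) * (1 + w n ω + y n ω)

namespace AdaptiveQueue

variable {Ω : Type*} [MeasurableSpace Ω] {P : Measure Ω} {ν : Measure (ℝ × ℝ)}
  {q₀ r₀ β ε ρ D K : ℝ} {q r w y : ℕ → Ω → ℝ} {Z : ℕ → Ω → ℝ × ℝ}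

lemma w_nonneg (H : AdaptiveQueue P ν q₀ r₀ D K q r w y Z) (n : ℕ) (ω : Ω) : 0 ≤ w n ω := by
  cases n with
  | zero => exact (H.w_zero ω).ge
  | succ n =>
    have := congrArg Prod.fst (H.step n ω)
    simp only at this
    rw [this]
    exact lindleyStep_nonneg _ _ _ _

lemma w_succ (H : AdaptiveQueue P ν q₀ r₀ D K q r w y Z) (n : ℕ) (ω : Ω) :
    w (n + 1) ω = lindleyStep (q n ω) (r n ω) (w n ω) (Z n ω) :=
  congrArg Prod.fst (H.step n ω)

lemma y_succ (H : AdaptiveQueue P ν q₀ r₀ D K q r w y Z) (n : ℕ) (ω : Ω) :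
    y (n + 1) ω = if 0 < w (n + 1) ω then y n ω + (Z n ω).1 * q n ω else 0 := by
  rw [H.w_succ]
  exact congrArg Prod.snd (H.step n ω)

lemma ae_nonneg_Z (H : AdaptiveQueue P ν q₀ r₀ D K q r w y Z) (h : ExpDrift ν q₀ r₀ β ε ρ)
    (n : ℕ) : ∀ᵐ ω ∂P, 0 ≤ (Z n ω).1 ∧ 0 ≤ (Z n ω).2 := by
  have h1 : ∀ᵐ z ∂(P.map (Z n)), 0 ≤ z.1 ∧ 0 ≤ z.2 := by
    rw [H.law n]
    exact h.nonneg
  exact ae_of_ae_map (H.measurable_Z n).aemeasurable h1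

lemma ae_y_nonneg (H : AdaptiveQueue P ν q₀ r₀ D K q r w y Z) (h : ExpDrift ν q₀ r₀ β ε ρ)
    (n : ℕ) : ∀ᵐ ω ∂P, 0 ≤ y n ω := by
  induction n with
  | zero => exact Filter.Eventually.of_forall fun ω => (H.y_zero ω).ge
  | succ n ih =>
    filter_upwards [ih, H.ae_nonneg_Z h n] with ω h1 h2
    rw [H.y_succ]
    have := mul_nonneg h2.1 (h.q₀_pos.le.trans (H.le_q n ω))
    split_ifs
    · linarith
    · exact le_rfl

/-- The exponential Lyapunov function has uniformly bounded moments. -/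
lemma moment_le [IsProbabilityMeasure P] (H : AdaptiveQueue P ν q₀ r₀ D K q r w y Z)
    (h : ExpDrift ν q₀ r₀ β ε ρ) (n : ℕ) :
    Integrable (fun ω => Real.exp (β * w n ω + ε * y n ω)) P ∧
      ∫ ω, Real.exp (β * w n ω + ε * y n ω) ∂P ≤ (1 - ρ)⁻¹ := by
  have hρ : 0 < 1 - ρ := by linarith [h.ρ_lt]
  have hm : ∀ n, Measurable (fun ω => Real.exp (β * w n ω + ε * y n ω)) := fun n =>
    (((H.measurable_w n).const_mul β).add ((H.measurable_y n).const_mul ε)).exp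
  induction n with
  | zero =>
    simp only [H.w_zero, H.y_zero, mul_zero, add_zero, Real.exp_zero, integral_const,
      probReal_univ, smul_eq_mul, mul_one]
    exact ⟨integrable_const _, (one_le_inv₀ hρ).2 (by linarith [h.ρ_pos])⟩
  | succ n ih =>
    obtain ⟨ih1, ih2⟩ := ih
    set e : ℝ × ℝ → ℝ := fun z => Real.exp (β * (z.2 * r₀) - (β - ε) * (z.1 * q₀)) with he
    have hem : Measurable e := by rw [he]; fun_prop
    have hei : Integrable (fun ω => e (Z n ω)) P := by
      have := h.integrable_exp
      rw [← H.law n] at this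
      exact this.comp_measurable (H.measurable_Z n)
    have hel : ∫ ω, e (Z n ω) ∂P ≤ ρ := by
      rw [← integral_map (H.measurable_Z n).aemeasurable hem.aestronglyMeasurable, H.law n]
      exact h.integral_exp_le
    have hind : IndepFun (fun ω => Real.exp (β * w n ω + ε * y n ω)) (fun ω => e (Z n ω)) P :=
      (H.indep n).comp (φ := fun x : ℝ × ℝ × ℝ × ℝ => Real.exp (β * x.2.2.1 + ε * x.2.2.2))
        (by fun_prop) hem
    have hpi : Integrable (fun ω => Real.exp (β * w n ω + ε * y n ω) * e (Z n ω)) P :=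
      hind.integrable_mul ih1 hei
    have hp : ∫ ω, Real.exp (β * w n ω + ε * y n ω) * e (Z n ω) ∂P ≤ (1 - ρ)⁻¹ * ρ := by
      rw [hind.integral_fun_mul_eq_mul_integral ih1.1 hei.1]
      refine mul_le_mul ih2 hel (integral_nonneg fun ω => (Real.exp_pos _).le) (by positivity)
    have hle : ∀ᵐ ω ∂P, Real.exp (β * w (n + 1) ω + ε * y (n + 1) ω) ≤
        1 + Real.exp (β * w n ω + ε * y n ω) * e (Z n ω) := by
      filter_upwards [H.ae_nonneg_Z h n] with ω hz
      have hpos := mul_pos (Real.exp_pos (β * w n ω + ε * y n ω))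
        (Real.exp_pos (β * ((Z n ω).2 * r₀) - (β - ε) * ((Z n ω).1 * q₀)))
      -- At an empty queue the Lyapunov function equals 1. Otherwise `q U` enters `w` negatively and
      -- `y` positively, so its net weight is `-(β - ε)`, as in `ExpDrift`.
      rcases (H.w_nonneg (n + 1) ω).eq_or_lt with h0 | h0
      · rw [H.y_succ, if_neg (by rw [← h0]; exact lt_irrefl 0), ← h0]
        simp only [mul_zero, add_zero, Real.exp_zero]
        linarith
      · have hy : y (n + 1) ω = y n ω + (Z n ω).1 * q n ω := by rw [H.y_succ, if_pos h0]
        have hw : w (n + 1) ω = w n ω - (Z n ω).1 * q n ω + (Z n ω).2 * r n ω := by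
          have h1 := H.w_succ n ω
          unfold lindleyStep at h1
          rcases max_choice (w n ω - (Z n ω).1 * q n ω + (Z n ω).2 * r n ω) 0 with h2 | h2
          · rw [h1, h2]
          · rw [h1, h2] at h0
            exact absurd h0 (lt_irrefl 0)
        have hle : Real.exp (β * w (n + 1) ω + ε * y (n + 1) ω) ≤
            Real.exp (β * w n ω + ε * y n ω) * e (Z n ω) := by
          rw [he, ← Real.exp_add, hy, hw]
          apply Real.exp_le_exp.2
          have h3 := mul_le_mul_of_nonneg_left
            (mul_le_mul_of_nonneg_left (H.r_le n ω) hz.2) h.β_pos.le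
          have h4 := mul_le_mul_of_nonneg_left
            (mul_le_mul_of_nonneg_left (H.le_q n ω) hz.1) (sub_nonneg.2 h.ε_le)
          linarith
        linarith
    have hi : Integrable (fun ω => Real.exp (β * w (n + 1) ω + ε * y (n + 1) ω)) P := by
      refine ((integrable_const 1).add hpi).mono' (hm _).aestronglyMeasurable ?_
      filter_upwards [hle] with ω hω
      rw [Real.norm_eq_abs, abs_of_pos (Real.exp_pos _)]
      exact hω
    refine ⟨hi, ?_⟩
    calc _ ≤ ∫ ω, (1 + Real.exp (β * w n ω + ε * y n ω) * e (Z n ω)) ∂P :=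
          integral_mono_ae hi ((integrable_const 1).add hpi) hle
      _ = 1 + ∫ ω, Real.exp (β * w n ω + ε * y n ω) * e (Z n ω) ∂P := by
          rw [integral_add (integrable_const 1) hpi]; simp
      -- `(1 - ρ)⁻¹` is the fixed point of `x ↦ 1 + ρ * x`.
      _ ≤ 1 + (1 - ρ)⁻¹ * ρ := by gcongr
      _ = (1 - ρ)⁻¹ := by field_simp; ring

lemma integrable_exp_w [IsProbabilityMeasure P] (H : AdaptiveQueue P ν q₀ r₀ D K q r w y Z)
    (h : ExpDrift ν q₀ r₀ β ε ρ) (n : ℕ) : Integrable (fun ω => Real.exp (β * w n ω)) P := by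
  refine (H.moment_le h n).1.mono' ((H.measurable_w n).const_mul β).exp.aestronglyMeasurable ?_
  filter_upwards [H.ae_y_nonneg h n] with ω hy
  rw [Real.norm_eq_abs, abs_of_pos (Real.exp_pos _)]
  exact Real.exp_le_exp.2 (by linarith [mul_nonneg h.ε_pos.le hy])

lemma integrable_w [IsProbabilityMeasure P] (H : AdaptiveQueue P ν q₀ r₀ D K q r w y Z)
    (h : ExpDrift ν q₀ r₀ β ε ρ) (n : ℕ) : Integrable (w n) P := by
  have := h.β_pos
  refine ((H.integrable_exp_w h n).const_mul β⁻¹).mono'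
    (H.measurable_w n).aestronglyMeasurable (Filter.Eventually.of_forall fun ω => ?_)
  rw [Real.norm_eq_abs, abs_of_nonneg (H.w_nonneg n ω), le_inv_mul_iff₀ this]
  linarith [Real.add_one_le_exp (β * w n ω)]

lemma integrable_exp_half_w [IsProbabilityMeasure P]
    (H : AdaptiveQueue P ν q₀ r₀ D K q r w y Z)
    (h : ExpDrift ν q₀ r₀ β ε ρ) (n : ℕ) : Integrable (fun ω => Real.exp (β / 2 * w n ω)) P := by
  refine (H.integrable_exp_w h n).mono'
    ((H.measurable_w n).const_mul _).exp.aestronglyMeasurable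
      (Filter.Eventually.of_forall fun ω => ?_)
  rw [Real.norm_eq_abs, abs_of_pos (Real.exp_pos _)]
  exact Real.exp_le_exp.2 (by nlinarith [mul_nonneg h.β_pos.le (H.w_nonneg n ω)])

end AdaptiveQueue

namespace AdaptiveQueue

variable {Ω : Type*} [MeasurableSpace Ω] {P : Measure Ω} {ν : Measure (ℝ × ℝ)}
  {q₀ r₀ β ε ρ D K : ℝ} {q r w y : ℕ → Ω → ℝ} {Z : ℕ → Ω → ℝ × ℝ}

lemma measurable_qrw (H : AdaptiveQueue P ν q₀ r₀ D K q r w y Z) (n n' : ℕ) :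
    Measurable (fun ω => (q n ω, r n ω, w n' ω)) :=
  (H.measurable_q n).prodMk ((H.measurable_r n).prodMk (H.measurable_w n'))

/-- No regularity of `m` is assumed; measurability is inherited from the approximating mean waiting
times. -/
lemma measurable_limit [IsProbabilityMeasure ν] (H : AdaptiveQueue P ν q₀ r₀ D K q r w y Z)
    {m : ℝ → ℝ → ℝ}
    (hlim : ∀ n ω x, 0 ≤ x → Filter.Tendsto (fun j => meanWait ν j (q n ω) (r n ω) x)
      Filter.atTop (nhds (m (q n ω) (r n ω)))) (n : ℕ) :
    Measurable (fun ω => m (q n ω) (r n ω)) := by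
  refine measurable_of_tendsto_metrizable (f := fun j ω => meanWait ν j (q n ω) (r n ω) (w n ω))
    (fun j => (measurable_meanWait ν j).comp (H.measurable_qrw n n)) ?_
  rw [tendsto_pi_nhds]
  exact fun ω => hlim n ω _ (H.w_nonneg n ω)

/-- Mean waiting times under frozen parameters, relative to their stationary limit, are
integrable along the process. -/
lemma integrable_meanWait_sub [IsProbabilityMeasure P] [IsProbabilityMeasure ν]
    (H : AdaptiveQueue P ν q₀ r₀ D K q r w y Z)
    (h : ExpDrift ν q₀ r₀ β ε ρ) {m : ℝ → ℝ → ℝ}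
    (hlim : ∀ n ω x, 0 ≤ x → Filter.Tendsto (fun j => meanWait ν j (q n ω) (r n ω) x)
      Filter.atTop (nhds (m (q n ω) (r n ω)))) (j n n' : ℕ) :
    Integrable (fun ω => meanWait ν j (q n ω) (r n ω) (w n' ω) - m (q n ω) (r n ω)) P := by
  obtain ⟨s, C, hs0, hs1, hC, hb⟩ := h.exists_abs_meanWait_sub_limit_le
  -- The initial parameters at one sample point `ω₀` serve as a fixed reference; `D` bounds the
  -- distance of all parameters to it, so the Lipschitz estimate in the parameters gives a
  -- dominating function.
  obtain ⟨ω₀⟩ := P.nonempty_of_neZero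
  have hdom : Integrable (fun ω => C * D * Real.exp (β / 2 * w n' ω) * s ^ j +
      (|meanWait ν j (q 0 ω₀) (r 0 ω₀) 0 - m (q 0 ω₀) (r 0 ω₀)| + w n' ω)) P :=
    (((H.integrable_exp_half_w h n').const_mul (C * D)).mul_const _).add
      ((integrable_const _).add (H.integrable_w h n'))
  refine hdom.mono' (((measurable_meanWait ν j).comp (H.measurable_qrw n n')).sub
    (H.measurable_limit hlim n)).aestronglyMeasurable (Filter.Eventually.of_forall fun ω => ?_)
  have hw := H.w_nonneg n' ω
  have h1 := hb _ _ _ _ (H.le_q n ω) (H.r_le n ω) (H.le_q 0 ω₀) (H.r_le 0 ω₀) (w n' ω) _ _ hw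
    (hlim n ω _ hw) (hlim 0 ω₀ _ hw) j
  have h2 := h.abs_meanWait_sub_le j (q 0 ω₀) (r 0 ω₀) (w n' ω) 0
  rw [sub_zero, abs_of_nonneg hw] at h2
  have h3 : C * (|q n ω - q 0 ω₀| + |r n ω - r 0 ω₀|) * Real.exp (β / 2 * w n' ω) * s ^ j ≤
      C * D * Real.exp (β / 2 * w n' ω) * s ^ j := by
    gcongr
    exact H.bounded n ω ω₀
  rw [Real.norm_eq_abs]
  set A := meanWait ν j (q n ω) (r n ω) (w n' ω) - m (q n ω) (r n ω)
  have h4 : A = (A - (meanWait ν j (q 0 ω₀) (r 0 ω₀) (w n' ω) - m (q 0 ω₀) (r 0 ω₀))) +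
      ((meanWait ν j (q 0 ω₀) (r 0 ω₀) (w n' ω) - meanWait ν j (q 0 ω₀) (r 0 ω₀) 0) +
      (meanWait ν j (q 0 ω₀) (r 0 ω₀) 0 - m (q 0 ω₀) (r 0 ω₀))) := by ring
  rw [h4]
  refine (abs_add_le _ _).trans (add_le_add (h1.trans h3) ((abs_add_le _ _).trans ?_))
  linarith

lemma integrable_limit [IsProbabilityMeasure P] [IsProbabilityMeasure ν]
    (H : AdaptiveQueue P ν q₀ r₀ D K q r w y Z)
    (h : ExpDrift ν q₀ r₀ β ε ρ) {m : ℝ → ℝ → ℝ}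
    (hlim : ∀ n ω x, 0 ≤ x → Filter.Tendsto (fun j => meanWait ν j (q n ω) (r n ω) x)
      Filter.atTop (nhds (m (q n ω) (r n ω)))) (n : ℕ) :
    Integrable (fun ω => m (q n ω) (r n ω)) P := by
  refine ((H.integrable_w h n).sub (H.integrable_meanWait_sub h hlim 0 n n)).congr
    (Filter.Eventually.of_forall fun ω => ?_)
  simp [meanWait]

/-- Freezing the parameters one step later: the first of the remaining steps may be taken by the
process itself. -/
lemma integral_meanWait_succ [IsProbabilityMeasure P] [IsProbabilityMeasure ν]
    (H : AdaptiveQueue P ν q₀ r₀ D K q r w y Z)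
    (h : ExpDrift ν q₀ r₀ β ε ρ) {m : ℝ → ℝ → ℝ}
    (hlim : ∀ n ω x, 0 ≤ x → Filter.Tendsto (fun j => meanWait ν j (q n ω) (r n ω) x)
      Filter.atTop (nhds (m (q n ω) (r n ω)))) (j n : ℕ) :
    ∫ ω, (meanWait ν (j + 1) (q n ω) (r n ω) (w n ω) - m (q n ω) (r n ω)) ∂P =
      ∫ ω, (meanWait ν j (q n ω) (r n ω) (w (n + 1) ω) - m (q n ω) (r n ω)) ∂P := by
  have hm := H.integrable_limit h hlim n
  have hi : ∀ k n', Integrable (fun ω => meanWait ν k (q n ω) (r n ω) (w n' ω)) P := fun k n' =>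
    ((H.integrable_meanWait_sub h hlim k n n').add hm).congr
      (Filter.Eventually.of_forall fun ω => by simp)
  rw [integral_sub (hi _ _) hm, integral_sub (hi _ _) hm]
  congr 1
  have hF : Measurable (fun p : (ℝ × ℝ × ℝ × ℝ) × ℝ × ℝ =>
      meanWait ν j p.1.1 p.1.2.1 (lindleyStep p.1.1 p.1.2.1 p.1.2.2.1 p.2)) := by
    refine (measurable_meanWait ν j).comp (f := fun p : (ℝ × ℝ × ℝ × ℝ) × ℝ × ℝ =>
      (p.1.1, p.1.2.1, lindleyStep p.1.1 p.1.2.1 p.1.2.2.1 p.2)) ?_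
    unfold lindleyStep
    fun_prop
  have hint := hi j (n + 1)
  simp only [H.w_succ] at hint ⊢
  exact ((H.indep n).integral_comp_prodMk ((H.measurable_q n).prodMk
    ((H.measurable_r n).prodMk ((H.measurable_w n).prodMk (H.measurable_y n))))
    (H.measurable_Z n) (H.law n) hF hint).symm

/-- The effect of one parameter update on the expected deviation from the stationary limit. -/
lemma exists_abs_integral_update_le [IsProbabilityMeasure P] [IsProbabilityMeasure ν]
    (H : AdaptiveQueue P ν q₀ r₀ D K q r w y Z)
    (h : ExpDrift ν q₀ r₀ β ε ρ) (hK : 0 ≤ K) {m : ℝ → ℝ → ℝ}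
    (hlim : ∀ n ω x, 0 ≤ x → Filter.Tendsto (fun j => meanWait ν j (q n ω) (r n ω) x)
      Filter.atTop (nhds (m (q n ω) (r n ω)))) :
    ∃ s C : ℝ, 0 < s ∧ s < 1 ∧ 0 ≤ C ∧ ∀ j n : ℕ,
    |∫ ω, (meanWait ν j (q (n + 1) ω) (r (n + 1) ω) (w (n + 1) ω) -
        m (q (n + 1) ω) (r (n + 1) ω)) ∂P -
      ∫ ω, (meanWait ν j (q n ω) (r n ω) (w (n + 1) ω) - m (q n ω) (r n ω)) ∂P| ≤
      C * s ^ j / ((n : ℝ) + 1) := by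
  obtain ⟨s, C, hs0, hs1, hC, hb⟩ := h.exists_abs_meanWait_sub_limit_le
  have hρ : 0 < 1 - ρ := by linarith [h.ρ_lt]
  set c := (1 + 2 / ε) ^ 2 with hc
  have hc0 : 0 ≤ c := by positivity
  refine ⟨s, C * K * (1 + c) * (1 - ρ)⁻¹, hs0, hs1, by positivity, fun j n => ?_⟩
  rw [← integral_sub (H.integrable_meanWait_sub h hlim j _ _)
    (H.integrable_meanWait_sub h hlim j _ _), ← Real.norm_eq_abs]
  obtain ⟨i1, b1⟩ := H.moment_le h n
  obtain ⟨i2, b2⟩ := H.moment_le h (n + 1)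
  have hint : Integrable (fun ω => C * (K / ((n : ℝ) + 1)) * s ^ j *
      (Real.exp (β * w (n + 1) ω + ε * y (n + 1) ω) +
        c * Real.exp (β * w n ω + ε * y n ω))) P := (i2.add (i1.const_mul c)).const_mul _
  refine (norm_integral_le_of_norm_le hint ?_).trans ?_
  · filter_upwards [H.drift n, H.ae_y_nonneg h n, H.ae_y_nonneg h (n + 1)] with ω hd hy hy'
    have hw := H.w_nonneg n ω
    have hw' := H.w_nonneg (n + 1) ω
    rw [Real.norm_eq_abs]
    refine (hb _ _ _ _ (H.le_q (n + 1) ω) (H.r_le (n + 1) ω) (H.le_q n ω) (H.r_le n ω)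
      (w (n + 1) ω) _ _ hw' (hlim _ ω _ hw') (hlim n ω _ hw') j).trans ?_
    set t := 1 + w n ω + y n ω with ht
    set E := Real.exp (β / 2 * w (n + 1) ω) with hE
    have ht2 : t ^ 2 ≤ c * Real.exp (β * w n ω + ε * y n ω) := by
      rw [ht, add_assoc]
      refine (one_add_sq_le_exp h.ε_pos (add_nonneg hw hy)).trans ?_
      rw [← hc]
      gcongr
      nlinarith [mul_le_mul_of_nonneg_right h.ε_le hw]
    have hE2 : E ^ 2 ≤ Real.exp (β * w (n + 1) ω + ε * y (n + 1) ω) := by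
      rw [hE, ← Real.exp_nat_mul]
      apply Real.exp_le_exp.2
      push_cast
      linarith [mul_nonneg h.ε_pos.le hy']
    -- The step size involves the state at time `n`, the Lipschitz constant that at time `n + 1`.
    -- Bounding the product by squares separates the two times, and the half exponent in `E` squares
    -- to the Lyapunov function.
    have hEt : t * E ≤ Real.exp (β * w (n + 1) ω + ε * y (n + 1) ω) +
        c * Real.exp (β * w n ω + ε * y n ω) := by
      nlinarith [sq_nonneg (t - E), sq_nonneg t, sq_nonneg E]
    calc _ ≤ C * (K / ((n : ℝ) + 1) * t) * E * s ^ j := by gcongr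
      _ = C * (K / ((n : ℝ) + 1)) * s ^ j * (t * E) := by ring
      _ ≤ _ := by gcongr
  · rw [integral_const_mul, integral_add i2 (i1.const_mul c), integral_const_mul]
    calc _ ≤ C * (K / ((n : ℝ) + 1)) * s ^ j * ((1 - ρ)⁻¹ + c * (1 - ρ)⁻¹) := by gcongr
      _ = _ := by ring

/-- The expected waiting time tracks the expected stationary mean waiting time under the current
parameters at rate `1 / n`. -/
theorem exists_abs_integral_sub_le [IsProbabilityMeasure P] [IsProbabilityMeasure ν]
    (H : AdaptiveQueue P ν q₀ r₀ D K q r w y Z)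
    (h : ExpDrift ν q₀ r₀ β ε ρ) (hK : 0 ≤ K) {m : ℝ → ℝ → ℝ}
    (hlim : ∀ n ω x, 0 ≤ x → Filter.Tendsto (fun j => meanWait ν j (q n ω) (r n ω) x)
      Filter.atTop (nhds (m (q n ω) (r n ω))))
    {s' K' : ℝ} (hs0' : 0 < s') (hs1' : s' < 1) (hK' : 0 ≤ K')
    (hrate : ∀ n ω, |meanWait ν n (q 0 ω) (r 0 ω) 0 - m (q 0 ω) (r 0 ω)| ≤ K' * s' ^ n) :
    ∃ C : ℝ, ∀ n : ℕ, |∫ ω, w n ω ∂P - ∫ ω, m (q n ω) (r n ω) ∂P| ≤ C / ((n : ℝ) + 1) := by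
  obtain ⟨s, C, hs0, hs1, hC, hup⟩ := H.exists_abs_integral_update_le h hK hlim
  obtain ⟨B, hB⟩ := exists_geometric_conv_harmonic_le hs0 hs1 hs0' hs1' hK' hC
  refine ⟨B, fun n => le_trans ?_ (hB n)⟩
  -- The process runs with its own parameters up to time `i`, then with those of time `i` frozen for
  -- the remaining `n - i` steps.
  set a : ℕ → ℝ := fun i =>
    ∫ ω, (meanWait ν (n - i) (q i ω) (r i ω) (w i ω) - m (q i ω) (r i ω)) ∂P with ha
  have han : a n = ∫ ω, w n ω ∂P - ∫ ω, m (q n ω) (r n ω) ∂P := by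
    rw [← integral_sub (H.integrable_w h n) (H.integrable_limit h hlim n), ha]
    simp [meanWait]
  have ha0 : |a 0| ≤ K' * s' ^ n := by
    rw [ha, ← Real.norm_eq_abs]
    refine (norm_integral_le_of_norm_le_const (C := K' * s' ^ n)
      (Filter.Eventually.of_forall fun ω => ?_)).trans (le_of_eq (by simp))
    rw [H.w_zero, Real.norm_eq_abs, Nat.sub_zero]
    exact hrate n ω
  have hstep : ∀ i ∈ Finset.range n, |a (i + 1) - a i| ≤
      C * s ^ (n - 1 - i) / ((i : ℝ) + 1) := by
    intro i hi
    have hin : i < n := Finset.mem_range.1 hi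
    have e1 : n - (i + 1) = n - 1 - i := by omega
    have e2 : n - i = (n - 1 - i) + 1 := by omega
    simp only [ha]
    -- After letting the process take the first frozen step, both terms have the same state and the
    -- same number of remaining steps, and differ only in the parameters.
    rw [e1, e2, H.integral_meanWait_succ h hlim]
    exact hup _ _
  have htel : a n = a 0 + ∑ i ∈ Finset.range n, (a (i + 1) - a i) := by
    rw [Finset.sum_range_sub]; ring
  rw [← han, htel]
  refine (abs_add_le _ _).trans (add_le_add ha0 ?_)
  exact (Finset.abs_sum_le_sum_abs _ _).trans (Finset.sum_le_sum hstep)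

end AdaptiveQueue

/-! ### Regrouping independent blocks. -/

lemma measurePreserving_prod_prod_comm {α β γ δ : Type*} [MeasurableSpace α] [MeasurableSpace β]
    [MeasurableSpace γ] [MeasurableSpace δ] (a : Measure α) (b : Measure β) (c : Measure γ)
    (d : Measure δ) [SFinite a] [SFinite b] [SFinite c] [SFinite d] :
    MeasurePreserving (fun x : (α × β) × γ × δ => ((x.1.1, x.2.1), (x.1.2, x.2.2)))
      ((a.prod b).prod (c.prod d)) ((a.prod c).prod (b.prod d)) := by
  have h1 : MeasurePreserving (MeasurableEquiv.prodAssoc : (α × β) × γ × δ ≃ᵐ α × β × γ × δ)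
      ((a.prod b).prod (c.prod d)) (a.prod (b.prod (c.prod d))) :=
    measurePreserving_prodAssoc a b (c.prod d)
  have h2 : MeasurePreserving (MeasurableEquiv.prodAssoc : (β × γ) × δ ≃ᵐ β × γ × δ).symm
      (b.prod (c.prod d)) ((b.prod c).prod d) := (measurePreserving_prodAssoc b c d).symm _
  have h3 : MeasurePreserving (Prod.map Prod.swap id) ((b.prod c).prod d) ((c.prod b).prod d) :=
    (Measure.measurePreserving_swap (μ := b) (ν := c)).prod (.id d)
  have h4 : MeasurePreserving (MeasurableEquiv.prodAssoc : (γ × β) × δ ≃ᵐ γ × β × δ)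
      ((c.prod b).prod d) (c.prod (b.prod d)) := measurePreserving_prodAssoc c b d
  have h5 : MeasurePreserving (MeasurableEquiv.prodAssoc : (α × γ) × β × δ ≃ᵐ α × γ × β × δ).symm
      (a.prod (c.prod (b.prod d))) ((a.prod c).prod (b.prod d)) :=
    (measurePreserving_prodAssoc a c (b.prod d)).symm _
  exact h5.comp (((MeasurePreserving.id a).prod (h4.comp (h3.comp h2))).comp h1)

/-- The joint law is a product of four marginals and can be regrouped. It turns independence of the
U's from the V's into independence of the past from the present. -/
lemma ProbabilityTheory.IndepFun.prodMk_prodMk_comm {Ω α β γ δ : Type*} [MeasurableSpace Ω]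
    [MeasurableSpace α] [MeasurableSpace β] [MeasurableSpace γ] [MeasurableSpace δ]
    {P : Measure Ω} [IsProbabilityMeasure P] {A : Ω → α} {B : Ω → β} {C : Ω → γ} {D : Ω → δ}
    (hA : Measurable A) (hB : Measurable B) (hC : Measurable C) (hD : Measurable D)
    (hAB : IndepFun A B P) (hCD : IndepFun C D P)
    (h : IndepFun (fun ω => (A ω, B ω)) (fun ω => (C ω, D ω)) P) :
    IndepFun (fun ω => (A ω, C ω)) (fun ω => (B ω, D ω)) P := by
  have hAC : IndepFun A C P := h.comp measurable_fst measurable_fst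
  have hBD : IndepFun B D P := h.comp measurable_snd measurable_snd
  rw [indepFun_iff_map_prod_eq_prod_map_map (by fun_prop) (by fun_prop)] at h hAC hBD hAB hCD ⊢
  rw [hAB, hCD] at h
  have := Measure.isProbabilityMeasure_map (μ := P) hA.aemeasurable
  have := Measure.isProbabilityMeasure_map (μ := P) hB.aemeasurable
  have := Measure.isProbabilityMeasure_map (μ := P) hC.aemeasurable
  have := Measure.isProbabilityMeasure_map (μ := P) hD.aemeasurable
  have hp := measurePreserving_prod_prod_comm (P.map A) (P.map B) (P.map C) (P.map D)
  rw [hAC, hBD, ← hp.map_eq, ← h, Measure.map_map hp.measurable (by fun_prop)]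
  rfl

/-! ### The algorithm as an adaptive queue. -/

namespace PricingModel

lemma queueStep_eq_busyStep (M : PricingModel) (μ p : ℝ) (x : ℝ × ℝ) (u v : ℝ) :
    M.queueStep μ p x u v = busyStep (M.lam p)⁻¹ μ⁻¹ x (u, v) := by
  simp only [queueStep, busyStep, lindleyStep, div_eq_mul_inv]
  congr

lemma iterateStep_w (M : PricingModel) (η u v : ℝ) (s : Iterate) :
    ((M.iterateStep η u v s).w, (M.iterateStep η u v s).y) =
      busyStep (M.lam s.p)⁻¹ s.mu⁻¹ (s.w, s.y) (u, v) := by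
  rw [← queueStep_eq_busyStep]
  rfl

namespace UniformlyStable

variable {M : PricingModel}

lemma pL_mem (hM : M.UniformlyStable) : M.pL ∈ Icc M.pL M.pU := left_mem_Icc.2 hM.p_lt.le

lemma pU_mem (hM : M.UniformlyStable) : M.pU ∈ Icc M.pL M.pU := right_mem_Icc.2 hM.p_lt.le

lemma muL_pos (hM : M.UniformlyStable) : 0 < M.muL := (hM.lam_pos _ hM.pL_mem).trans hM.stable

lemma inv_lam_ge (hM : M.UniformlyStable) {p : ℝ} (hp : p ∈ Icc M.pL M.pU) :
    (M.lam M.pL)⁻¹ ≤ (M.lam p)⁻¹ :=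
  inv_anti₀ (hM.lam_pos p hp) (hM.lam_anti hM.pL_mem hp hp.1)

lemma inv_mu_le (hM : M.UniformlyStable) {μ : ℝ} (hμ : μ ∈ Icc M.muL M.muU) : μ⁻¹ ≤ M.muL⁻¹ :=
  inv_anti₀ hM.muL_pos hμ.1

lemma samcmc_mem (hM : M.UniformlyStable) {η : ℕ → ℝ} {μ₁ p₁ : ℝ} (hμ₁ : μ₁ ∈ Icc M.muL M.muU)
    (hp₁ : p₁ ∈ Icc M.pL M.pU) (u v : ℕ → ℝ) (n : ℕ) :
    (M.samcmc η μ₁ p₁ u v n).mu ∈ Icc M.muL M.muU ∧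
      (M.samcmc η μ₁ p₁ u v n).p ∈ Icc M.pL M.pU := by
  cases n with
  | zero => exact ⟨hμ₁, hp₁⟩
  | succ n =>
    exact ⟨⟨le_max_left _ _, max_le hM.mu_lt.le (min_le_left _ _)⟩,
      ⟨le_max_left _ _, max_le hM.p_lt.le (min_le_left _ _)⟩⟩

lemma continuousOn_derivWithin_c (hM : M.UniformlyStable) :
    ContinuousOn (derivWithin M.c (Icc M.muL M.muU)) (Icc M.muL M.muU) :=
  hM.c_contDiff.continuousOn_derivWithin (uniqueDiffOn_Icc hM.mu_lt) le_rfl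

lemma continuousOn_derivWithin_lam (hM : M.UniformlyStable) :
    ContinuousOn (derivWithin M.lam (Icc M.pL M.pU)) (Icc M.pL M.pU) :=
  hM.lam_contDiff.continuousOn_derivWithin (uniqueDiffOn_Icc hM.p_lt) le_rfl

/-- Outside the interval `g` is arbitrary, so it is replaced by its constant continuous extension.
-/
lemma measurable_comp_of_continuousOn_Icc {Ω : Type*} [MeasurableSpace Ω] {a b : ℝ} (hab : a ≤ b)
    {g : ℝ → ℝ} (hg : ContinuousOn g (Icc a b)) {f : Ω → ℝ} (hf : Measurable f)
    (hmem : ∀ ω, f ω ∈ Icc a b) : Measurable (fun ω => g (f ω)) := by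
  have h1 : Measurable (IccExtend hab ((Icc a b).domRestrict g)) :=
    (continuousOn_iff_continuous_domRestrict.1 hg).Icc_extend'.measurable
  have h2 : (fun ω => g (f ω)) = IccExtend hab ((Icc a b).domRestrict g) ∘ f :=
    funext fun ω => by simp [IccExtend_of_mem hab _ (hmem ω)]
  rw [h2]
  exact h1.comp hf

lemma measurable_samcmc (hM : M.UniformlyStable) {η : ℕ → ℝ}
    {μ₁ p₁ : ℝ} (hμ₁ : μ₁ ∈ Icc M.muL M.muU)
    (hp₁ : p₁ ∈ Icc M.pL M.pU) {Ω : Type*} [MeasurableSpace Ω] {u v : Ω → ℕ → ℝ}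
    (hu : Measurable u) (hv : Measurable v) (n : ℕ) :
    Measurable (fun ω => (M.samcmc η μ₁ p₁ (u ω) (v ω) n).mu) ∧
    Measurable (fun ω => (M.samcmc η μ₁ p₁ (u ω) (v ω) n).p) ∧
    Measurable (fun ω => (M.samcmc η μ₁ p₁ (u ω) (v ω) n).w) ∧
    Measurable (fun ω => (M.samcmc η μ₁ p₁ (u ω) (v ω) n).y) ∧
    Measurable (fun ω => M.lam (M.samcmc η μ₁ p₁ (u ω) (v ω) n).p) := by
  have hlam : ∀ n, Measurable (fun ω => (M.samcmc η μ₁ p₁ (u ω) (v ω) n).p) →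
      Measurable (fun ω => M.lam (M.samcmc η μ₁ p₁ (u ω) (v ω) n).p) := fun n h =>
    measurable_comp_of_continuousOn_Icc hM.p_lt.le hM.lam_contDiff.continuousOn h
      fun ω => (hM.samcmc_mem hμ₁ hp₁ _ _ n).2
  induction n with
  | zero =>
    exact ⟨measurable_const, measurable_const, measurable_const, measurable_const,
      hlam 0 measurable_const⟩
  | succ n ih =>
    obtain ⟨h1, h2, h3, h4, h5⟩ := ih
    have hc := measurable_comp_of_continuousOn_Icc hM.mu_lt.le hM.continuousOn_derivWithin_c h1
      fun ω => (hM.samcmc_mem hμ₁ hp₁ _ _ n).1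
    have hl := measurable_comp_of_continuousOn_Icc hM.p_lt.le hM.continuousOn_derivWithin_lam h2
      fun ω => (hM.samcmc_mem hμ₁ hp₁ _ _ n).2
    have hun : Measurable (fun ω => u ω n) := (measurable_pi_apply n).comp hu
    have hvn : Measurable (fun ω => v ω n) := (measurable_pi_apply n).comp hv
    have hp : Measurable (fun ω => (M.samcmc η μ₁ p₁ (u ω) (v ω) (n + 1)).p) := by
      simp only [samcmc, iterateStep, gradP]
      fun_prop
    have hw : Measurable (fun ω => (M.samcmc η μ₁ p₁ (u ω) (v ω) (n + 1)).w) := by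
      simp only [samcmc, iterateStep, queueStep]
      fun_prop
    refine ⟨?_, hp, hw, ?_, hlam _ hp⟩
    · simp only [samcmc, iterateStep, gradMu]
      fun_prop
    · exact Measurable.ite (measurableSet_lt measurable_const hw) (h4.add (hun.div h5))
        measurable_const

end UniformlyStable

lemma samcmc_congr (M : PricingModel) (η : ℕ → ℝ) (μ₁ p₁ : ℝ) {u v u' v' : ℕ → ℝ} (n : ℕ)
    (hu : ∀ k < n, u k = u' k) (hv : ∀ k < n, v k = v' k) :
    M.samcmc η μ₁ p₁ u v n = M.samcmc η μ₁ p₁ u' v' n := by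
  induction n with
  | zero => rfl
  | succ n ih =>
    simp only [samcmc]
    rw [ih (fun k hk => hu k (hk.trans n.lt_succ_self))
      (fun k hk => hv k (hk.trans n.lt_succ_self)),
      hu n n.lt_succ_self, hv n n.lt_succ_self]

end PricingModel

namespace PricingModel

lemma indepFun_samcmc {Ω : Type*} [MeasurableSpace Ω] {P : Measure Ω} [IsProbabilityMeasure P]
    {M : PricingModel} (hM : M.UniformlyStable) {U V : ℕ → Ω → ℝ} (hUV : IsPrimitiveInput P U V)
    {η : ℕ → ℝ} {μ₁ p₁ : ℝ} (hμ₁ : μ₁ ∈ Icc M.muL M.muU) (hp₁ : p₁ ∈ Icc M.pL M.pU) (n : ℕ)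
    {X : ℕ → Ω → Iterate}
    (hX : X = fun n ω => M.samcmc η μ₁ p₁ (fun k => U k ω) (fun k => V k ω) n) :
    IndepFun (fun ω => ((M.lam (X n ω).p)⁻¹, (X n ω).mu⁻¹, (X n ω).w, (X n ω).y))
      (fun ω => (U n ω, V n ω)) P := by
  set S := Finset.range n with hS
  have hdisj : Disjoint S {n} := by simp [hS]
  -- The iterate with index `n` uses only inputs with index below `n`, so padding the past by zeros
  -- makes it a measurable function of finitely many inputs.
  let ext : (S → ℝ) → ℕ → ℝ := fun f k => if h : k ∈ S then f ⟨k, h⟩ else 0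
  have hext : Measurable ext := by
    refine measurable_pi_lambda _ fun k => ?_
    by_cases h : k ∈ S
    · simp only [ext, h, dif_pos]; exact measurable_pi_apply _
    · simp only [ext, h, dif_neg, not_false_eq_true]; exact measurable_const
  have hU := (hUV.iIndep_U.indepFun_finset S {n} hdisj hUV.measurable_U).comp measurable_id
    (measurable_pi_apply (⟨n, by simp⟩ : ({n} : Finset ℕ)))
  have hV := (hUV.iIndep_V.indepFun_finset S {n} hdisj hUV.measurable_V).comp measurable_id
    (measurable_pi_apply (⟨n, by simp⟩ : ({n} : Finset ℕ)))
  have hr : Measurable (fun f : ℕ → ℝ => ((fun i : S => f i), f n)) :=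
    (measurable_pi_lambda _ fun i => measurable_pi_apply _).prodMk (measurable_pi_apply n)
  have hUVn := hUV.indep_UV.comp hr hr
  have hind := IndepFun.prodMk_prodMk_comm
    (A := fun ω (i : S) => U i ω) (B := U n) (C := fun ω (i : S) => V i ω) (D := V n)
    (measurable_pi_lambda _ fun i => hUV.measurable_U i) (hUV.measurable_U n)
    (measurable_pi_lambda _ fun i => hUV.measurable_V i) (hUV.measurable_V n) hU hV hUVn
  obtain ⟨m1, -, m3, m4, m5⟩ := hM.measurable_samcmc (η := η) hμ₁ hp₁
    (Ω := (S → ℝ) × (S → ℝ)) (u := fun x => ext x.1) (v := fun x => ext x.2)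
    (hext.comp measurable_fst) (hext.comp measurable_snd) n
  have hres := hind.comp (m5.inv.prodMk (m1.inv.prodMk (m3.prodMk m4))) measurable_id
  have hXe : ∀ ω, X n ω = M.samcmc η μ₁ p₁ (ext fun i => U i ω) (ext fun i => V i ω) n := by
    intro ω
    rw [hX]
    refine M.samcmc_congr η μ₁ p₁ n (fun k hk => ?_) (fun k hk => ?_) <;>
      simp [ext, hS, hk]
  simp only [hXe]
  exact hres

lemma map_prodMk_eq_of_isPrimitiveInput {Ω : Type*} [MeasurableSpace Ω] {P : Measure Ω}
    [IsProbabilityMeasure P] {U V : ℕ → Ω → ℝ} (hUV : IsPrimitiveInput P U V) (n : ℕ) :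
    P.map (fun ω => (U n ω, V n ω)) = (P.map (U 0)).prod (P.map (V 0)) := by
  have h : IndepFun (U n) (V n) P :=
    hUV.indep_UV.comp (measurable_pi_apply n) (measurable_pi_apply n)
  rw [indepFun_iff_map_prod_eq_prod_map_map (hUV.measurable_U n).aemeasurable
    (hUV.measurable_V n).aemeasurable] at h
  rw [h, (hUV.ident_U n).map_eq, (hUV.ident_V n).map_eq]

lemma exists_expDrift {Ω : Type*} [MeasurableSpace Ω] {P : Measure Ω} [IsProbabilityMeasure P]
    {M : PricingModel} (hM : M.UniformlyStable) {U V : ℕ → Ω → ℝ} (hUV : IsPrimitiveInput P U V)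
    (hLT : M.LightTailed P (U 0) (V 0)) :
    ∃ β ε ρ, ExpDrift ((P.map (U 0)).prod (P.map (V 0))) (M.lam M.pL)⁻¹ M.muL⁻¹ β ε ρ := by
  obtain ⟨-, -, -, -, θ, a, γ, hθ, -, ha, ha', hγ, hcU, hcV, hiV⟩ := hLT
  have hl := hM.lam_pos _ hM.pL_mem
  have hmu := hM.muL_pos
  rw [lt_div_iff₀ (by linarith)] at ha'
  have ha1 : a < 1 := by nlinarith
  have h1a : 0 < 1 - a := by linarith
  have mU := hUV.measurable_U 0
  have mV := hUV.measurable_V 0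
  have := Measure.isProbabilityMeasure_map (μ := P) mU.aemeasurable
  have := Measure.isProbabilityMeasure_map (μ := P) mV.aemeasurable
  have nU : ∀ᵐ x ∂(P.map (U 0)), 0 ≤ x :=
    (ae_map_iff mU.aemeasurable measurableSet_Ici).2 (hUV.nonneg_U 0)
  have nV : ∀ᵐ x ∂(P.map (V 0)), 0 ≤ x :=
    (ae_map_iff mV.aemeasurable measurableSet_Ici).2 (hUV.nonneg_V 0)
  have iU : Integrable (fun x => x) (P.map (U 0)) :=
    (integrable_map_measure (by fun_prop) mU.aemeasurable).2 hUV.integrable_U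
  have iV : Integrable (fun x => x) (P.map (V 0)) :=
    (integrable_map_measure (by fun_prop) mV.aemeasurable).2 hUV.integrable_V
  have eV : Integrable (fun x => Real.exp (θ / (1 + a) * x)) (P.map (V 0)) :=
    (integrable_map_measure (by fun_prop) mV.aemeasurable).2 hiV
  have eU : Integrable (fun x => Real.exp (-θ / (1 - a) * x)) (P.map (U 0)) := by
    refine Integrable.of_bound (C := 1) (by fun_prop) ?_
    filter_upwards [nU] with x hx
    rw [Real.norm_eq_abs, abs_of_pos (Real.exp_pos _), Real.exp_le_one_iff, neg_div, neg_mul,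
      neg_nonpos]
    positivity
  have bU : ∫ x, Real.exp (-θ / (1 - a) * x) ∂(P.map (U 0)) ≤ Real.exp (-θ - γ / 2) := by
    rw [integral_map mU.aemeasurable (by fun_prop)]
    rw [cgf] at hcU
    refine ((Real.log_lt_iff_lt_exp (mgf_pos ?_)).1 hcU).le
    exact (integrable_map_measure (by fun_prop) mU.aemeasurable).1 eU
  have bV : ∫ x, Real.exp (θ / (1 + a) * x) ∂(P.map (V 0)) ≤ Real.exp (θ - γ / 2) := by
    rw [integral_map mV.aemeasurable (by fun_prop)]
    rw [cgf] at hcV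
    exact ((Real.log_lt_iff_lt_exp (mgf_pos hiV)).1 hcV).le
  have hexp : ∀ z : ℝ × ℝ, Real.exp (θ * M.muL / (1 + a) * (z.2 * M.muL⁻¹) -
      (θ * M.muL / (1 + a) - (θ * M.muL / (1 + a) - θ * M.lam M.pL / (1 - a))) *
        (z.1 * (M.lam M.pL)⁻¹)) =
      Real.exp (-θ / (1 - a) * z.1) * Real.exp (θ / (1 + a) * z.2) := by
    intro z
    rw [← Real.exp_add]
    congr 1
    field_simp
    ring
  -- `β` and `β - ε` are chosen so that, after scaling by `r₀` and `q₀`, the exponents become `θ /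
  -- (1 + a)` for the service time and `θ / (1 - a)` for the interarrival time. The two cumulant
  -- bounds add up to `-γ`.
  refine ⟨θ * M.muL / (1 + a), θ * M.muL / (1 + a) - θ * M.lam M.pL / (1 - a), Real.exp (-γ),
    ?_, iU.comp_fst _, iV.comp_snd _, inv_pos.2 hl, inv_pos.2 hmu, ?_, ?_, Real.exp_pos _, ?_,
    ?_, ?_, ?_⟩
  · filter_upwards [Measure.quasiMeasurePreserving_fst.ae nU,
      Measure.quasiMeasurePreserving_snd.ae nV] with z h1 h2
    exact ⟨h1, h2⟩
  -- Positivity of `ε` amounts to `λ(pL) (1 + a) < muL (1 - a)`, which is the upper bound on `a`.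
  · rw [sub_pos, div_lt_div_iff₀ h1a (by linarith)]
    nlinarith
  · rw [sub_le_self_iff]
    positivity
  · rw [Real.exp_lt_one_iff]
    linarith
  · simp only [hexp]
    exact eU.mul_prod eV
  · simp only [hexp]
    rw [integral_prod_mul (fun x => Real.exp (-θ / (1 - a) * x))
      (fun x => Real.exp (θ / (1 + a) * x))]
    calc _ ≤ Real.exp (-θ - γ / 2) * Real.exp (θ - γ / 2) := by
          gcongr
      _ = _ := by rw [← Real.exp_add]; congr 1; ring
  · have hc : 0 < θ / (1 + a) := by positivity
    have hw : Integrable (fun x => Real.exp (θ / (1 + a) / 2 * x) * (1 + x)) (P.map (V 0)) := by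
      refine (eV.const_mul (1 + 2 / (θ / (1 + a)))).mono' (by fun_prop) ?_
      filter_upwards [nV] with x hx
      rw [Real.norm_eq_abs, abs_of_nonneg (by positivity)]
      calc _ ≤ Real.exp (θ / (1 + a) / 2 * x) *
            ((1 + 2 / (θ / (1 + a))) * Real.exp (θ / (1 + a) / 2 * x)) := by
            gcongr
            exact one_add_le_mul_exp hc hx
        _ = (1 + 2 / (θ / (1 + a))) *
            (Real.exp (θ / (1 + a) / 2 * x) * Real.exp (θ / (1 + a) / 2 * x)) := by ring
        _ = _ := by rw [← Real.exp_add]; congr 2; ring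
    have hh : Integrable (fun x => Real.exp (θ / (1 + a) / 2 * x)) (P.map (V 0)) := by
      refine hw.mono' (by fun_prop) ?_
      filter_upwards [nV] with x hx
      rw [Real.norm_eq_abs, abs_of_pos (Real.exp_pos _)]
      exact le_mul_of_one_le_right (Real.exp_pos _).le (by linarith)
    refine ((hw.comp_snd (P.map (U 0))).add (iU.mul_prod hh)).congr
      (Filter.Eventually.of_forall fun z => ?_)
    have e1 : θ * M.muL / (1 + a) / 2 * (z.2 * M.muL⁻¹) = θ / (1 + a) / 2 * z.2 := by
      field_simp
    simp only [Pi.add_apply, e1]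
    ring

lemma abs_clip_sub_le {a b x t : ℝ} (hx : x ∈ Icc a b) : |max a (min b (x - t)) - x| ≤ |t| := by
  obtain ⟨h1, h2⟩ := hx
  rcases abs_cases t with ⟨h3, h4⟩ | ⟨h3, h4⟩ <;> rw [h3, abs_le] <;>
    rcases max_cases a (min b (x - t)) with ⟨h5, h6⟩ | ⟨h5, h6⟩ <;>
    rcases min_cases b (x - t) with ⟨h7, h8⟩ | ⟨h7, h8⟩ <;> constructor <;> linarith

lemma abs_inv_sub_inv_le {l x y : ℝ} (hl : 0 < l) (hx : l ≤ x) (hy : l ≤ y) :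
    |x⁻¹ - y⁻¹| ≤ (l ^ 2)⁻¹ * |x - y| := by
  have hx0 := hl.trans_le hx
  have hy0 := hl.trans_le hy
  rw [inv_sub_inv hx0.ne' hy0.ne', abs_div, abs_of_pos (mul_pos hx0 hy0), abs_sub_comm,
    div_eq_inv_mul]
  gcongr
  rw [sq]
  gcongr

namespace UniformlyStable

variable {M : PricingModel}

/-- All coefficients are bounded on the compact box; only the state enters the estimator
unboundedly, and it does so linearly. -/
lemma exists_abs_grad_le (hM : M.UniformlyStable) : ∃ G : ℝ, 0 ≤ G ∧ ∀ s : Iterate,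
    s.mu ∈ Icc M.muL M.muU → s.p ∈ Icc M.pL M.pU → 0 ≤ s.w → 0 ≤ s.y →
    |M.gradMu s| ≤ G * (1 + s.w + s.y) ∧ |M.gradP s| ≤ G * (1 + s.w + s.y) := by
  obtain ⟨B, hB⟩ := isCompact_Icc.exists_bound_of_continuousOn hM.continuousOn_derivWithin_c
  obtain ⟨L, hL⟩ := isCompact_Icc.exists_bound_of_continuousOn hM.continuousOn_derivWithin_lam
  have hB0 : 0 ≤ B := (norm_nonneg _).trans (hB M.muL (left_mem_Icc.2 hM.mu_lt.le))
  have hL0 : 0 ≤ L := (norm_nonneg _).trans (hL M.pL hM.pL_mem)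
  have hl := hM.lam_pos _ hM.pL_mem
  have hmu := hM.muL_pos
  set R := 1 + M.muL⁻¹ with hR
  have hR0 : 0 ≤ R := by positivity
  set G1 := B + |M.h0| * (M.lam M.pL * M.muL⁻¹) * R with hG1
  set G2 := M.lam M.pL + (|M.pL| + |M.pU|) * L + |M.h0| * L * R with hG2
  have hG10 : 0 ≤ G1 := by positivity
  have hG20 : 0 ≤ G2 := by positivity
  refine ⟨G1 + G2, by positivity, fun s hmus hps hw hy => ?_⟩
  set T := 1 + s.w + s.y with hT
  have hT1 : 1 ≤ T := by linarith
  have hsmu : 0 < s.mu := hmu.trans_le hmus.1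
  have hinv : 1 / s.mu ≤ M.muL⁻¹ := by rw [one_div]; exact hM.inv_mu_le hmus
  have hls := hM.lam_pos _ hps
  have hlsle : M.lam s.p ≤ M.lam M.pL := hM.lam_anti hM.pL_mem hps hps.1
  have hQ0 : 0 ≤ s.w + s.y + 1 / s.mu := by positivity
  have hQ : s.w + s.y + 1 / s.mu ≤ R * T := by
    have : 0 ≤ M.muL⁻¹ := by positivity
    nlinarith
  have hp : |s.p| ≤ |M.pL| + |M.pU| := by
    refine abs_le.2 ⟨?_, ?_⟩
    · linarith [neg_abs_le M.pL, abs_nonneg M.pU, hps.1]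
    · linarith [le_abs_self M.pU, abs_nonneg M.pL, hps.2]
  have hBs := hB _ hmus
  have hLs := hL _ hps
  rw [Real.norm_eq_abs] at hBs hLs
  constructor
  · have h1 : |M.gradMu s| ≤ G1 * T := by
      rw [gradMu]
      refine (abs_sub _ _).trans ?_
      rw [abs_mul, abs_mul, abs_of_nonneg hQ0, abs_of_nonneg (div_nonneg hls.le hsmu.le)]
      calc _ ≤ B * T + |M.h0| * (M.lam M.pL * M.muL⁻¹) * (R * T) := by
            rw [div_eq_mul_inv]
            gcongr
            · nlinarith
            · exact hmus.1
        _ = _ := by ring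
    nlinarith
  · have h2 : |M.gradP s| ≤ G2 * T := by
      rw [gradP]
      refine (abs_add_le _ _).trans (le_trans (add_le_add (abs_sub _ _) le_rfl) ?_)
      rw [abs_neg, abs_mul, abs_mul, abs_mul, abs_of_nonneg hQ0, abs_of_pos hls]
      calc _ ≤ M.lam M.pL * T + (|M.pL| + |M.pU|) * L * T + |M.h0| * L * (R * T) := by
            refine add_le_add (add_le_add ?_ ?_) ?_
            · nlinarith
            · refine le_trans ?_ (le_mul_of_one_le_right (by positivity) hT1)
              gcongr
            · gcongr
        _ = _ := by ring
    nlinarith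

lemma exists_abs_lam_sub_le (hM : M.UniformlyStable) : ∃ L : ℝ, 0 ≤ L ∧
    ∀ p ∈ Icc M.pL M.pU, ∀ p' ∈ Icc M.pL M.pU, |M.lam p - M.lam p'| ≤ L * |p - p'| := by
  obtain ⟨L, hL⟩ := isCompact_Icc.exists_bound_of_continuousOn hM.continuousOn_derivWithin_lam
  refine ⟨L, (norm_nonneg _).trans (hL M.pL hM.pL_mem), fun p hp p' hp' => ?_⟩
  exact (convex_Icc _ _).norm_image_sub_le_of_norm_derivWithin_le
    (hM.lam_contDiff.differentiableOn one_ne_zero) hL hp' hp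

/-- One iteration changes the scaling factors of the queue by at most a constant multiple of the
step size times the size of the state. -/
lemma exists_drift_le (hM : M.UniformlyStable) : ∃ K : ℝ, 0 ≤ K ∧ ∀ (η u v : ℝ) (s : Iterate),
    0 ≤ η → s.mu ∈ Icc M.muL M.muU → s.p ∈ Icc M.pL M.pU → 0 ≤ s.w → 0 ≤ s.y →
    |(M.lam (M.iterateStep η u v s).p)⁻¹ - (M.lam s.p)⁻¹| +
      |(M.iterateStep η u v s).mu⁻¹ - s.mu⁻¹| ≤ η * K * (1 + s.w + s.y) := by
  obtain ⟨G, hG0, hG⟩ := hM.exists_abs_grad_le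
  obtain ⟨L, hL0, hL⟩ := hM.exists_abs_lam_sub_le
  have hlU := hM.lam_pos _ hM.pU_mem
  have hmu := hM.muL_pos
  refine ⟨((M.lam M.pU ^ 2)⁻¹ * L + (M.muL ^ 2)⁻¹) * G, by positivity,
    fun η u v s hη hmus hps hw hy => ?_⟩
  obtain ⟨g1, g2⟩ := hG s hmus hps hw hy
  have hmem1 : (M.iterateStep η u v s).mu ∈ Icc M.muL M.muU :=
    ⟨le_max_left _ _, max_le hM.mu_lt.le (min_le_left _ _)⟩
  have hmem2 : (M.iterateStep η u v s).p ∈ Icc M.pL M.pU :=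
    ⟨le_max_left _ _, max_le hM.p_lt.le (min_le_left _ _)⟩
  have d1 : |(M.iterateStep η u v s).mu - s.mu| ≤ η * (G * (1 + s.w + s.y)) := by
    refine (abs_clip_sub_le hmus).trans ?_
    rw [abs_mul, abs_of_nonneg hη]
    gcongr
  have d2 : |(M.iterateStep η u v s).p - s.p| ≤ η * (G * (1 + s.w + s.y)) := by
    refine (abs_clip_sub_le hps).trans ?_
    rw [abs_mul, abs_of_nonneg hη]
    gcongr
  have e1 := abs_inv_sub_inv_le hmu hmem1.1 hmus.1
  have e2 := abs_inv_sub_inv_le hlU (hM.lam_anti hmem2 hM.pU_mem hmem2.2)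
    (hM.lam_anti hps hM.pU_mem hps.2)
  have e3 := hL _ hmem2 _ hps
  calc _ ≤ (M.lam M.pU ^ 2)⁻¹ * (L * (η * (G * (1 + s.w + s.y)))) +
        (M.muL ^ 2)⁻¹ * (η * (G * (1 + s.w + s.y))) := by
        refine add_le_add (e2.trans ?_) (e1.trans ?_)
        · gcongr
          exact e3.trans (by gcongr)
        · gcongr
    _ = _ := by ring

end UniformlyStable

lemma ae_samcmc_nonneg {Ω : Type*} [MeasurableSpace Ω] {P : Measure Ω}
    {M : PricingModel} (hM : M.UniformlyStable) {U V : ℕ → Ω → ℝ} (hUV : IsPrimitiveInput P U V)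
    {η : ℕ → ℝ} {μ₁ p₁ : ℝ} (hμ₁ : μ₁ ∈ Icc M.muL M.muU) (hp₁ : p₁ ∈ Icc M.pL M.pU) (n : ℕ) :
    ∀ᵐ ω ∂P, 0 ≤ (M.samcmc η μ₁ p₁ (fun k => U k ω) (fun k => V k ω) n).w ∧
      0 ≤ (M.samcmc η μ₁ p₁ (fun k => U k ω) (fun k => V k ω) n).y := by
  induction n with
  | zero => exact Filter.Eventually.of_forall fun ω => ⟨le_rfl, le_rfl⟩
  | succ n ih =>
    filter_upwards [ih, hUV.nonneg_U n] with ω h1 h2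
    refine ⟨le_max_right _ _, ?_⟩
    have h3 := (hM.lam_pos _ (hM.samcmc_mem (η := η) hμ₁ hp₁ (fun k => U k ω)
      (fun k => V k ω) n).2).le
    simp only [samcmc, iterateStep, queueStep]
    split_ifs
    · exact add_nonneg h1.2 (div_nonneg h2 h3)
    · exact le_rfl

lemma exists_adaptiveQueue {Ω : Type*} [MeasurableSpace Ω] {P : Measure Ω}
    [IsProbabilityMeasure P] {M : PricingModel} (hM : M.UniformlyStable) {U V : ℕ → Ω → ℝ}
    (hUV : IsPrimitiveInput P U V) {γ : ℝ} (hγ : 0 < γ) {μ₁ p₁ : ℝ}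
    (hμ₁ : μ₁ ∈ Icc M.muL M.muU) (hp₁ : p₁ ∈ Icc M.pL M.pU) {X : ℕ → Ω → Iterate}
    (hX : X = fun n ω => M.samcmc (fun t => γ / t) μ₁ p₁ (fun k => U k ω) (fun k => V k ω) n) :
    ∃ D K : ℝ, 0 ≤ K ∧ AdaptiveQueue P ((P.map (U 0)).prod (P.map (V 0))) (M.lam M.pL)⁻¹
      M.muL⁻¹ D K (fun n ω => (M.lam (X n ω).p)⁻¹) (fun n ω => (X n ω).mu⁻¹)
      (fun n ω => (X n ω).w) (fun n ω => (X n ω).y) (fun n ω => (U n ω, V n ω)) := by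
  obtain ⟨K, hK0, hK⟩ := hM.exists_drift_le
  have hmeas := fun n => hM.measurable_samcmc (η := fun t => γ / t) hμ₁ hp₁ (Ω := Ω)
    (u := fun ω k => U k ω) (v := fun ω k => V k ω)
    (measurable_pi_lambda _ hUV.measurable_U) (measurable_pi_lambda _ hUV.measurable_V) n
  have hmem : ∀ n ω, (X n ω).mu ∈ Icc M.muL M.muU ∧ (X n ω).p ∈ Icc M.pL M.pU := by
    intro n ω
    rw [hX]
    exact hM.samcmc_mem hμ₁ hp₁ _ _ n
  have hsucc : ∀ n ω, X (n + 1) ω = M.iterateStep (γ / ((n : ℝ) + 1)) (U n ω) (V n ω) (X n ω) := by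
    intro n ω
    rw [hX]
    simp [samcmc]
  refine ⟨(M.lam M.pU)⁻¹ + M.muL⁻¹, γ * K, by positivity, ?_⟩
  refine
    { measurable_q := fun n => by rw [hX]; exact (hmeas n).2.2.2.2.inv
      measurable_r := fun n => by rw [hX]; exact (hmeas n).1.inv
      measurable_w := fun n => by rw [hX]; exact (hmeas n).2.2.1
      measurable_y := fun n => by rw [hX]; exact (hmeas n).2.2.2.1
      measurable_Z := fun n => (hUV.measurable_U n).prodMk (hUV.measurable_V n)
      le_q := fun n ω => hM.inv_lam_ge (hmem n ω).2
      r_le := fun n ω => hM.inv_mu_le (hmem n ω).1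
      indep := fun n => indepFun_samcmc hM hUV hμ₁ hp₁ n hX
      law := map_prodMk_eq_of_isPrimitiveInput hUV
      step := fun n ω => by rw [hsucc]; exact M.iterateStep_w _ _ _ _
      w_zero := fun ω => by rw [hX]; rfl
      y_zero := fun ω => by rw [hX]; rfl
      bounded := fun n ω ω' => ?_
      drift := fun n => ?_ }
  · have hdist : ∀ {x x' B : ℝ}, 0 ≤ x → 0 ≤ x' → x ≤ B → x' ≤ B → |x - x'| ≤ B :=
      fun h1 h2 h3 h4 => abs_le.2 ⟨by linarith, by linarith⟩
    have hq : ∀ n ω, 0 ≤ (M.lam (X n ω).p)⁻¹ ∧ (M.lam (X n ω).p)⁻¹ ≤ (M.lam M.pU)⁻¹ := fun n ω =>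
      ⟨(inv_pos.2 (hM.lam_pos _ (hmem n ω).2)).le, inv_anti₀ (hM.lam_pos _ hM.pU_mem)
        (hM.lam_anti (hmem n ω).2 hM.pU_mem (hmem n ω).2.2)⟩
    have hr : ∀ n ω, 0 ≤ (X n ω).mu⁻¹ ∧ (X n ω).mu⁻¹ ≤ M.muL⁻¹ := fun n ω =>
      ⟨inv_nonneg.2 (hM.muL_pos.le.trans (hmem n ω).1.1), hM.inv_mu_le (hmem n ω).1⟩
    exact add_le_add (hdist (hq n ω).1 (hq 0 ω').1 (hq n ω).2 (hq 0 ω').2)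
      (hdist (hr n ω).1 (hr 0 ω').1 (hr n ω).2 (hr 0 ω').2)
  · filter_upwards [ae_samcmc_nonneg (η := fun t => γ / t) hM hUV hμ₁ hp₁ n] with ω hω
    have hω' : 0 ≤ (X n ω).w ∧ 0 ≤ (X n ω).y := by rw [hX]; exact hω
    rw [hsucc]
    refine (hK _ _ _ _ (by positivity) (hmem n ω).1 (hmem n ω).2 hω'.1 hω'.2).trans (le_of_eq ?_)
    ring

/-! ### Steady state of the model and the conclusion. -/

lemma isStationary_iff (M : PricingModel) (νU νV : Measure ℝ) (μ p : ℝ) (π : Measure (ℝ × ℝ)) :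
    M.IsStationary νU νV μ p π ↔ IsProbabilityMeasure π ∧ (∀ᵐ x ∂π, 0 ≤ x.1 ∧ 0 ≤ x.2) ∧
      (π.prod (νU.prod νV)).map (fun z => busyStep (M.lam p)⁻¹ μ⁻¹ z.1 z.2) = π := by
  constructor
  · rintro ⟨h1, h2, h3⟩
    simp only [queueStep_eq_busyStep] at h3
    exact ⟨h1, h2, h3⟩
  · rintro ⟨h1, h2, h3⟩
    refine ⟨h1, h2, ?_⟩
    simp only [queueStep_eq_busyStep]
    exact h3

/-- Existence and uniqueness of the stationary distribution, with exponential moments. -/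
lemma UniformlyStable.steadyLaw_spec {M : PricingModel} (hM : M.UniformlyStable)
    {νU νV : Measure ℝ} [IsProbabilityMeasure νU] [IsProbabilityMeasure νV] {β ε ρ : ℝ}
    (h : ExpDrift (νU.prod νV) (M.lam M.pL)⁻¹ M.muL⁻¹ β ε ρ) {μ p : ℝ}
    (hμ : μ ∈ Icc M.muL M.muU) (hp : p ∈ Icc M.pL M.pU) :
    (∃! π : Measure (ℝ × ℝ), M.IsStationary νU νV μ p π) ∧
      M.IsStationary νU νV μ p (M.steadyLaw νU νV μ p) ∧
      Integrable (fun x => Real.exp (β * x.1)) (M.steadyLaw νU νV μ p) := by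
  obtain ⟨π, h1, h2, h3, h4⟩ := h.exists_stationary (hM.inv_lam_ge hp) (hM.inv_mu_le hμ)
  have hst := (M.isStationary_iff νU νV μ p π).2 ⟨h1, h2, h3⟩
  have huniq : ∀ π', M.IsStationary νU νV μ p π' → π' = π := fun π' h' => by
    obtain ⟨g1, g2, g3⟩ := (M.isStationary_iff νU νV μ p π').1 h'
    exact h.stationary_unique (hM.inv_lam_ge hp) (hM.inv_mu_le hμ) g2 h2 g3 h3
  have hex : ∃! π : Measure (ℝ × ℝ), M.IsStationary νU νV μ p π := ⟨π, hst, huniq⟩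
  have heq : M.steadyLaw νU νV μ p = π := by
    rw [steadyLaw, dif_pos hex]
    exact huniq _ hex.exists.choose_spec
  rw [heq]
  exact ⟨hex, hst, h4⟩

end PricingModel

theorem lemma4p1 {Ω : Type*} [MeasurableSpace Ω] (P : Measure Ω) [IsProbabilityMeasure P]
    (M : PricingModel) (hM : M.UniformlyStable)
    (U V : ℕ → Ω → ℝ) (hUV : IsPrimitiveInput P U V) (hLT : M.LightTailed P (U 0) (V 0))
    (γ : ℝ) (hγ : 0 < γ)
    (μ₁ p₁ : ℝ) (hμ₁ : μ₁ ∈ Icc M.muL M.muU) (hp₁ : p₁ ∈ Icc M.pL M.pU)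
    (X : ℕ → Ω → Iterate)
    (hX : X = fun n ω => M.samcmc (fun t => γ / t) μ₁ p₁ (fun k => U k ω) (fun k => V k ω) n)
    (m : ℝ → ℝ → ℝ) (hm : m = M.steadyMeanWait (P.map (U 0)) (P.map (V 0))) :
    (∀ μ ∈ Icc M.muL M.muU, ∀ p ∈ Icc M.pL M.pU,
      (∃! π : Measure (ℝ × ℝ), M.IsStationary (P.map (U 0)) (P.map (V 0)) μ p π) ∧
      Integrable (fun x : ℝ × ℝ => x.1) (M.steadyLaw (P.map (U 0)) (P.map (V 0)) μ p)) ∧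
    (∀ n : ℕ, Integrable (fun ω => (X n ω).w) P ∧
      Integrable (fun ω => m (X n ω).mu (X n ω).p) P) ∧
    ∃ C : ℝ, ∀ n : ℕ,
      |∫ ω, (X n ω).w ∂P - ∫ ω, m (X n ω).mu (X n ω).p ∂P| ≤ C / ((n : ℝ) + 1) := by
  have := Measure.isProbabilityMeasure_map (μ := P) (hUV.measurable_U 0).aemeasurable
  have := Measure.isProbabilityMeasure_map (μ := P) (hUV.measurable_V 0).aemeasurable
  obtain ⟨β, ε, ρ, h⟩ := PricingModel.exists_expDrift hM hUV hLT
  obtain ⟨D, K, hK, H⟩ := PricingModel.exists_adaptiveQueue hM hUV hγ hμ₁ hp₁ hX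
  obtain ⟨s, hs0, hs1, hrate⟩ := h.exists_abs_meanWait_sub_stationary_le
  set ν := (P.map (U 0)).prod (P.map (V 0)) with hν
  have hrate' : ∀ μ ∈ Icc M.muL M.muU, ∀ p ∈ Icc M.pL M.pU, ∀ w, 0 ≤ w → ∃ K' : ℝ, ∀ n : ℕ,
      |meanWait ν n (M.lam p)⁻¹ μ⁻¹ w - m μ p| ≤ K' * s ^ n := by
    intro μ hμ p hp w hw
    obtain ⟨-, hst, hexp⟩ := hM.steadyLaw_spec h hμ hp
    obtain ⟨g1, g2, g3⟩ := (M.isStationary_iff _ _ μ p _).1 hst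
    rw [hm]
    exact hrate _ _ _ (hM.inv_lam_ge hp) (hM.inv_mu_le hμ) g1 g2 g3 hexp w hw
  have hlim' : ∀ μ ∈ Icc M.muL M.muU, ∀ p ∈ Icc M.pL M.pU, ∀ w, 0 ≤ w →
      Filter.Tendsto (fun n => meanWait ν n (M.lam p)⁻¹ μ⁻¹ w) Filter.atTop (nhds (m μ p)) := by
    intro μ hμ p hp w hw
    obtain ⟨K', hK'⟩ := hrate' μ hμ p hp w hw
    rw [tendsto_iff_dist_tendsto_zero]
    refine squeeze_zero (fun _ => dist_nonneg) (fun n => (Real.dist_eq _ _).trans_le (hK' n)) ?_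
    simpa using (tendsto_pow_atTop_nhds_zero_of_lt_one hs0.le hs1).const_mul K'
  -- The adaptive queue needs the steady-state mean as a function of `(q, r)`. Since `λ` need not be
  -- injective, it is defined as a limit of mean waiting times instead of by inverting the
  -- parametrization.
  set m' : ℝ → ℝ → ℝ := fun q r =>
    Filter.limUnder Filter.atTop (fun n => meanWait ν n q r 0) with hm'
  have hmm' : ∀ μ ∈ Icc M.muL M.muU, ∀ p ∈ Icc M.pL M.pU, m' (M.lam p)⁻¹ μ⁻¹ = m μ p :=
    fun μ hμ p hp => (hlim' μ hμ p hp 0 le_rfl).limUnder_eq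
  have hmem : ∀ n ω, (X n ω).mu ∈ Icc M.muL M.muU ∧ (X n ω).p ∈ Icc M.pL M.pU := by
    intro n ω
    rw [hX]
    exact hM.samcmc_mem hμ₁ hp₁ _ _ n
  have hmX : ∀ n ω, m' (M.lam (X n ω).p)⁻¹ (X n ω).mu⁻¹ = m (X n ω).mu (X n ω).p := fun n ω =>
    hmm' _ (hmem n ω).1 _ (hmem n ω).2
  have hlim : ∀ n ω x, 0 ≤ x → Filter.Tendsto
      (fun j => meanWait ν j (M.lam (X n ω).p)⁻¹ (X n ω).mu⁻¹ x) Filter.atTop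
      (nhds (m' (M.lam (X n ω).p)⁻¹ (X n ω).mu⁻¹)) := fun n ω x hx => by
    rw [hmX]
    exact hlim' _ (hmem n ω).1 _ (hmem n ω).2 x hx
  refine ⟨fun μ hμ p hp => ?_, fun n => ⟨H.integrable_w h n, ?_⟩, ?_⟩
  · obtain ⟨hex, hst, hexp⟩ := hM.steadyLaw_spec h hμ hp
    exact ⟨hex, h.integrable_fst_of_exp hst.nonneg hexp⟩
  · simpa only [hmX] using H.integrable_limit h hlim n
  -- The rate constant may depend on the parameter, but it is used only at the deterministic
  -- starting point.
  · obtain ⟨K', hK'⟩ := hrate' μ₁ hμ₁ p₁ hp₁ 0 le_rfl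
    have hK0 : 0 ≤ K' := by simpa using (abs_nonneg _).trans (hK' 0)
    have h0 : ∀ ω, X 0 ω = ⟨μ₁, p₁, 0, 0⟩ := fun ω => by rw [hX]; rfl
    have := H.exists_abs_integral_sub_le h hK hlim hs0 hs1 hK0 fun n ω => by
      rw [hmX, h0]
      exact hK' n
    simpa only [hmX] using this
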